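/- Let $f(z,w)=(p(z),q(z,w))$ be a germ at $0$ of a holomorphic map $(\mathbb C^2,0)\to(\mathbb C^2,0)$ for which the origin is a superattracting fixed point, i.e. $f(0)=0$ and both eigenvalues of $Df(0)$ are zero. Write $p(z)=a_\delta z^\delta+O(z^{\delta+1})$ with $a_\delta\neq0$ (so $\delta\ge2$) and $q(z,w)=\sum_{i,j\ge0} b_{ij}z^iw^j$. Let $N(q)$ be the convex hull of $\bigcup_{b_{ij}\neq0}\{(x,y)\in\mathbb R^2: x\ge i,\ y\ge j\}$, let $(n_1,m_1),\dots,(n_s,m_s)$ be its vertices, with $n_1<\dots<n_s$ and $m_1>\dots>m_s$, and for $1\le k\le s-1$ let $T_k$ be the $y$-intercept of the line through $(n_k,m_k)$ and $(n_{k+1},m_{k+1})$; put $\lambda_k=\frac{n_{k+1}-n_k}{m_k-m_{k+1}}$. Let $(\gamma,d)$, $0\le l_1<\infty$ and $0<l_2\le\infty$ be given by one of the following cases (if several apply, the assertion holds for each): 1. $s=1$: $(\gamma,d)=(n_1,m_1)$, $l_1=l_2^{-1}=0$. 2. $s>1$ and $\delta\le T_{s-1}$: $(\gamma,d)=(n_s,m_s)$,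 $l_1=\lambda_{s-1}$, $l_2^{-1}=0$. 3. $s>1$ and $T_1\le\delta$: $(\gamma,d)=(n_1,m_1)$, $l_1=0$, $l_2=\lambda_1$. 4. $s>1$ and $T_k\le\delta\le T_{k-1}$ for some $2\le k\le s-1$: $(\gamma,d)=(n_k,m_k)$, $l_1=\lambda_{k-1}$, $l_1+l_2=\lambda_k$. Let $f_0(z,w)=(a_\delta z^\delta,\ b_{\gamma d}z^\gamma w^d)$, let $\|(z,w)\|=\max\{|z|,|w|\}$, and for $r>0$ let $$U_r=\{(z,w)\in\mathbb C^2:\ |z|^{l_1l_2^{-1}+1}<r|w|^{l_2^{-1}},\ |w|<r|z|^{l_1}\}\qquad(0^0=1).$$ **Theorem.** If $d\ge2$, then there are $r_0>0$ and a map $\phi:U_{r_0}\cup\{0\}\to\mathbb C^2$ with $\phi(0)=0$ such that: (a) For every $0<r\le r_0$, $\phi$ maps the open set $U_r$ biholomorphically onto an open subset of $\mathbb C^2$, $f(U_r)\subset U_r\cup\{0\}$, and $\phi\circ f=f_0\circ\phi$ on $U_r$. More precisely, $f(z,w)\in U_r$ for every $(z,w)\in U_r$, except possibly if $\gamma\ge1$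 and $z=0$, when $f(z,w)$ may be the origin. (b) On $U_{r_0}$, $\phi$ is the uniform limit of $\phi_n=f_0^{-n}\circ f^n$. Here $\phi_n$ is holomorphic on $U_{r_0}$ with $f_0^n\circ\phi_n=f^n$, and the branch of $f_0^{-n}$ is the one normalized by $f_0^{-n}\circ f_0^n=\mathrm{id}$; that is, $\phi_n(z,w)=(z(1+o(1)),\,w(1+o(1)))$ uniformly on $U_r$ as $r\to0$. (c) For every $\varepsilon>0$ there is $0<r\le r_0$ such that $\|\phi(x)-x\|<\varepsilon\|x\|$ for all $x\in U_r$, $x\neq0$. -/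

import Mathlib

open Filter Topology

namespace SkewBottcher

/-- The skew product `(z, w) ↦ (p z, q (z, w))`. -/
def skew (p : ℂ → ℂ) (q : ℂ × ℂ → ℂ) (x : ℂ × ℂ) : ℂ × ℂ := (p x.1, q x)

/-- The origin is a superattracting fixed point of `f`: it is fixed, and all eigenvalues of the
derivative of `f` there are zero. -/
def IsSuperattracting (f : ℂ × ℂ → ℂ × ℂ) : Prop :=
  f 0 = 0 ∧ ∀ μ : ℂ,
    Module.End.HasEigenvalue ((fderiv ℂ f 0 : ℂ × ℂ →L[ℂ] ℂ × ℂ) : ℂ × ℂ →ₗ[ℂ] ℂ × ℂ) μ → μ = 0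

/-- The double power series with coefficients `b i j` converges (absolutely) to `q (z, w)` at every
point `(z, w)` of some neighbourhood of the origin. -/
def HasExpansion (q : ℂ × ℂ → ℂ) (b : ℕ → ℕ → ℂ) : Prop :=
  ∀ᶠ x : ℂ × ℂ in 𝓝 0,
    HasSum (fun ij : ℕ × ℕ => b ij.1 ij.2 * x.1 ^ ij.1 * x.2 ^ ij.2) (q x)

/-- The quadrant `D(i, j) = {(x, y) | x ≥ i, y ≥ j}`. -/
def quadrant (i j : ℕ) : Set (ℝ × ℝ) := {v | (i : ℝ) ≤ v.1 ∧ (j : ℝ) ≤ v.2}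

/-- The Newton polygon: the convex hull of the union of the `D(i, j)` with `b i j ≠ 0`. -/
def newtonPolygon (b : ℕ → ℕ → ℂ) : Set (ℝ × ℝ) :=
  convexHull ℝ {v | ∃ i j : ℕ, b i j ≠ 0 ∧ v ∈ quadrant i j}

/-- `(n 1, m 1), …, (n s, m s)` are all the vertices (extreme points) of the Newton polygon,
listed from left to right: `n 1 < ⋯ < n s` and `m 1 > ⋯ > m s`. -/
structure IsVertexList (b : ℕ → ℕ → ℂ) (s : ℕ) (n m : ℕ → ℕ) : Prop where
  vertices : (newtonPolygon b).extremePoints ℝ =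
    {v | ∃ k, 1 ≤ k ∧ k ≤ s ∧ v = ((n k : ℝ), (m k : ℝ))}
  strictMono : StrictMonoOn n (Set.Icc 1 s)
  strictAnti : StrictAntiOn m (Set.Icc 1 s)

/-- `(n (k+1) - n k) / (m k - m (k+1))`, minus the inverse of the slope of the line `L k` through
`(n k, m k)` and `(n (k+1), m (k+1))`. -/
noncomputable def invSlope (n m : ℕ → ℕ) (k : ℕ) : ℝ :=
  ((n (k + 1) : ℝ) - n k) / ((m k : ℝ) - m (k + 1))

/-- The `y`-intercept `T k` of the line `L k` through `(n k, m k)` and `(n (k+1), m (k+1))`. -/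
noncomputable def yIntercept (n m : ℕ → ℕ) (k : ℕ) : ℝ :=
  (m k : ℝ) + (n k : ℝ) * (((m k : ℝ) - m (k + 1)) / ((n (k + 1) : ℝ) - n k))

/-- `IsDominant δ s n m γ d l₁ l₂inv`: the exponent `(γ, d)` of a dominant term, and the weights
`l₁` and `l₂inv = l₂⁻¹` (zero if `l₂ = ∞`), as determined by `δ` and the vertices in each of the
four cases. If `δ` is equal to some `T k`, then there are two admissible choices. -/
inductive IsDominant (δ s : ℕ) (n m : ℕ → ℕ) : ℕ → ℕ → ℝ → ℝ → Prop
  | case1 (hs : s = 1) : IsDominant δ s n m (n 1) (m 1) 0 0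
  | case2 (hs : 1 < s) (hT : (δ : ℝ) ≤ yIntercept n m (s - 1)) :
      IsDominant δ s n m (n s) (m s) (invSlope n m (s - 1)) 0
  | case3 (hs : 1 < s) (hT : yIntercept n m 1 ≤ (δ : ℝ)) :
      IsDominant δ s n m (n 1) (m 1) 0 (invSlope n m 1)⁻¹
  | case4 (k : ℕ) (hk : 2 ≤ k) (hks : k ≤ s - 1) (hT : yIntercept n m k ≤ (δ : ℝ))
      (hT' : (δ : ℝ) ≤ yIntercept n m (k - 1)) (l₁ l₂ : ℝ)
      (h₁ : l₁ = invSlope n m (k - 1)) (h₂ : l₁ + l₂ = invSlope n m k) :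
      IsDominant δ s n m (n k) (m k) l₁ l₂⁻¹

/-- The open set
`U_r = {|z| ^ (l₁ l₂⁻¹ + 1) < r |w| ^ (l₂⁻¹), |w| < r |z| ^ l₁}`
(where `0 ^ 0 = 1`, so that `U_r = {|z| < r, |w| < r |z| ^ l₁}` if `l₂⁻¹ = 0`). -/
def wedge (l₁ l₂inv r : ℝ) : Set (ℂ × ℂ) :=
  {x | ‖x.1‖ ^ (l₁ * l₂inv + 1) < r * ‖x.2‖ ^ l₂inv ∧ ‖x.2‖ < r * ‖x.1‖ ^ l₁}

/-- The monomial map `(z, w) ↦ (a z ^ δ, c z ^ γ w ^ d)`. -/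
def monomialMap (a c : ℂ) (δ γ d : ℕ) (x : ℂ × ℂ) : ℂ × ℂ :=
  (a * x.1 ^ δ, c * x.1 ^ γ * x.2 ^ d)

/-- `φ` maps `U` biholomorphically onto an open set. -/
def IsBiholomorphicOn (φ : ℂ × ℂ → ℂ × ℂ) (U : Set (ℂ × ℂ)) : Prop :=
  IsOpen U ∧ IsOpen (φ '' U) ∧ DifferentiableOn ℂ φ U ∧
    ∃ ψ : ℂ × ℂ → ℂ × ℂ, DifferentiableOn ℂ ψ (φ '' U) ∧ ∀ x ∈ U, ψ (φ x) = x

/-- `g` is the branch of `f₀⁻ⁿ ∘ fⁿ` on `U r₀` that is normalized by `f₀⁻ⁿ ∘ f₀ⁿ = id`: it is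
holomorphic, `f₀ⁿ ∘ g = fⁿ`, and `g (z, w) = (z (1 + o(1)), w (1 + o(1)))` on `U r` as `r → 0`.
The last condition selects the branch, because any two holomorphic solutions of the equation on
the complement of `{zw = 0}` in `U r₀` differ by constant roots of unity in each coordinate. -/
structure IsBranch (f f₀ : ℂ × ℂ → ℂ × ℂ) (U : ℝ → Set (ℂ × ℂ)) (r₀ : ℝ) (n : ℕ)
    (g : ℂ × ℂ → ℂ × ℂ) : Prop where
  holomorphic : DifferentiableOn ℂ g (U r₀)
  equation : ∀ x ∈ U r₀, f₀^[n] (g x) = f^[n] x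
  normalized : ∀ ε > 0, ∃ r, 0 < r ∧ r ≤ r₀ ∧ ∀ x ∈ U r,
    ‖(g x).1 - x.1‖ ≤ ε * ‖x.1‖ ∧ ‖(g x).2 - x.2‖ ≤ ε * ‖x.2‖

end SkewBottcher

/-! Write L = l₂⁻¹, σ = log|w| - l₁ log|z| and τ = log|z| - Lσ. In these coordinates U_r is the
quadrant σ, τ < log r, and f₀ acts, up to additive constants, by a matrix with nonnegative entries
and diagonal entries at least 2. The Newton polygon and the position of δ among the T_k encode
exactly this (`IsDominant.isAdmissible`). Laurent monomials with exponents in the dual cone are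
bounded on U_r by a power of r (`norm_laurent_le`), and every other term of q divided by the
dominant one is of this kind, with a positive power. Hence q = b z^γ w^d (1 + ζ) and p = a z^δ (1 +
η), where ζ and η tend to 0 uniformly on U_r as r → 0, and small wedges are invariant
(`IsAdmissible.mem_wedge`), up to points that fall into the origin.

Write φ_n = (z exp U_n, w exp V_n). The logarithm of f₀ ∘ φ_{n+1} = φ_n ∘ f is the affine recursion
δ U_{n+1} = U_n ∘ p + log(1 + η), d V_{n+1} = V_n ∘ f + log(1 + ζ) - γ U_{n+1}, in which no branch
of a root has to be chosen. As δ, d ≥ 2, the divisions contract: U_n and V_n converge geometrically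
and are as small as the errors. The limits u, v define φ.

Since u and v are small on a larger wedge, Cauchy's estimates make z exp u(z) and, for fixed z, w
exp v(z, w) injective with nonzero derivative. As φ is triangular, it is biholomorphic
(`isBiholomorphicOn_twist`). -/

namespace SkewBottcher

open Metric Set

/-! ### Holomorphic maps on normed spaces: Cauchy estimates, uniform limits, inverses. -/

section SeveralVariables

variable {E F : Type*} [NormedAddCommGroup E] [NormedAddCommGroup F]

theorem mapsTo_closedBall_of_norm_le {f : E → F} {c : E} {R M : ℝ}
    (hM : ∀ x ∈ ball c R, ‖f x‖ ≤ M) : MapsTo f (ball c R) (closedBall (f c) (2 * M)) := by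
  intro x hx
  rw [mem_closedBall, dist_eq_norm]
  linarith [norm_sub_le (f x) (f c), hM x hx, hM c (mem_ball_self (pos_of_mem_ball hx))]

theorem ball_half_subset {x y : E} {R : ℝ} (hy : y ∈ ball x (R / 2)) :
    ball y (R / 2) ⊆ ball x R :=
  ball_subset_ball' (by linarith [mem_ball.1 hy])

variable [NormedSpace ℂ E] [NormedSpace ℂ F]

/-- Cauchy's estimate for the derivative of a bounded holomorphic map on a ball. -/
theorem norm_fderiv_le_of_norm_le {f : E → F} {c : E} {R M : ℝ} (hR : 0 < R)
    (hd : DifferentiableOn ℂ f (ball c R)) (hM : ∀ x ∈ ball c R, ‖f x‖ ≤ M) :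
    ‖fderiv ℂ f c‖ ≤ 2 * M / R :=
  Complex.norm_fderiv_le_div_of_mapsTo_ball hd (mapsTo_closedBall_of_norm_le hM) hR

/-- Cauchy's estimate for the increments of a bounded holomorphic map on a ball. -/
theorem dist_le_of_norm_le {f : E → F} {c x : E} {R M : ℝ}
    (hd : DifferentiableOn ℂ f (ball c R)) (hM : ∀ x ∈ ball c R, ‖f x‖ ≤ M)
    (hx : x ∈ ball c R) : dist (f x) (f c) ≤ 2 * M / R * dist x c :=
  Complex.dist_le_div_mul_dist_of_mapsTo_ball hd (mapsTo_closedBall_of_norm_le hM) hx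

/-- A uniform limit of holomorphic maps is holomorphic. -/
theorem differentiableOn_of_tendstoUniformlyOn [CompleteSpace F] {ι : Type*} {l : Filter ι}
    [l.NeBot] {f : ι → E → F} {g : E → F} {s : Set E} (hs : IsOpen s)
    (hf : ∀ n, DifferentiableOn ℂ (f n) s) (hfg : TendstoUniformlyOn f g l s) :
    DifferentiableOn ℂ g s := by
  intro x hx
  obtain ⟨R, hR, hRs⟩ := Metric.isOpen_iff.1 hs x hx
  have hsub : ∀ y ∈ ball x (R / 2), ball y (R / 2) ⊆ s := fun y hy =>
    (ball_half_subset hy).trans hRs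
  -- Cauchy's estimate on balls of radius R / 2 turns the uniform Cauchy property of the maps into
  -- that of their derivatives; the tolerance ε R / 8 becomes ε / 2.
  have hcau : UniformCauchySeqOn (fun n => fderiv ℂ (f n)) l (ball x (R / 2)) := by
    intro u hu
    obtain ⟨ε, hε, hεu⟩ := Metric.mem_uniformity_dist.1 hu
    have := hfg.uniformCauchySeqOn _ (Metric.dist_mem_uniformity (show 0 < ε * R / 8 by positivity))
    filter_upwards [this] with mn hmn y hy
    refine hεu ?_
    have hd : ∀ n, DifferentiableOn ℂ (f n) (ball y (R / 2)) := fun n => (hf n).mono (hsub y hy)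
    have hda : ∀ n, DifferentiableAt ℂ (f n) y := fun n =>
      (hd n).differentiableAt (ball_mem_nhds y (by positivity))
    rw [dist_eq_norm, ← fderiv_fun_sub (hda _) (hda _)]
    have := norm_fderiv_le_of_norm_le (M := ε * R / 8) (half_pos hR)
      ((hd mn.1).fun_sub (hd mn.2)) fun z hz => by
        rw [← dist_eq_norm]; exact (hmn z (hsub y hy hz)).le
    refine this.trans_lt ?_
    have : 2 * (ε * R / 8) / (R / 2) = ε / 2 := by field_simp; norm_num
    linarith
  have hlim : ∀ y ∈ ball x (R / 2), ∃ L, Tendsto (fun n => fderiv ℂ (f n) y) l (𝓝 L) :=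
    fun y hy => CompleteSpace.complete (hcau.cauchy_map hy)
  choose! g' hg' using hlim
  have hxb : x ∈ ball x (R / 2) := mem_ball_self (half_pos hR)
  have hbs : ball x (R / 2) ⊆ s := (ball_subset_ball (by linarith)).trans hRs
  refine (hasFDerivAt_of_tendstoUniformlyOn isOpen_ball
    (hcau.tendstoUniformlyOn_of_tendsto hg') (fun n y hy => ?_)
    (fun y hy => hfg.tendsto_at (hbs hy)) hxb).differentiableAt.differentiableWithinAt
  exact ((hf n).differentiableAt (hs.mem_nhds (hbs hy))).hasFDerivAt

/-- The derivative of a holomorphic map is continuous. -/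
theorem continuousAt_fderiv_of_differentiableOn {f : E → F} {s : Set E} (hs : IsOpen s)
    (hf : DifferentiableOn ℂ f s) {x : E} (hx : x ∈ s) : ContinuousAt (fderiv ℂ f) x := by
  obtain ⟨R, hR, hRs, hRM⟩ : ∃ R > 0, ball x R ⊆ s ∧ ∀ y ∈ ball x R, ‖f y‖ ≤ ‖f x‖ + 1 := by
    have hc : ContinuousAt f x := (hf.differentiableAt (hs.mem_nhds hx)).continuousAt
    have := (hc.norm.eventually (gt_mem_nhds (lt_add_one ‖f x‖))).and (hs.mem_nhds hx)
    obtain ⟨R, hR, h⟩ := Metric.eventually_nhds_iff_ball.1 this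
    exact ⟨R, hR, fun y hy => (h y hy).2, fun y hy => (h y hy).1.le⟩
  set M := ‖f x‖ + 1
  have key : ∀ y ∈ ball x (R / 4), ‖fderiv ℂ f y - fderiv ℂ f x‖ ≤
      2 * (2 * M / (R / 2) * dist y x) / (R / 4) := by
    intro y hy
    have hd : ∀ h ∈ ball (0 : E) (R / 4), ∀ z ∈ ball x (R / 4), DifferentiableAt ℂ f (h + z) := by
      intro h hh z hz
      refine hf.differentiableAt (hs.mem_nhds (hRs ?_))
      rw [mem_ball, dist_eq_norm] at *
      have := norm_add_le h (z - x)
      rw [sub_zero] at hh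
      rw [add_sub_assoc]; linarith
    have hshift : ∀ h z : E, DifferentiableAt ℂ f (h + z) →
        DifferentiableAt ℂ (fun k => f (k + z)) h := fun h z hz =>
      DifferentiableAt.comp h hz (differentiableAt_id.add_const z)
    have h0 : (0 : E) ∈ ball (0 : E) (R / 4) := mem_ball_self (by positivity)
    have hxx : x ∈ ball x (R / 4) := mem_ball_self (by positivity)
    -- The difference of the two derivatives is the derivative at 0 of the difference of two
    -- translates of `f`, which is itself O(dist y x) by the increment estimate.
    have := norm_fderiv_le_of_norm_le (f := fun h => f (h + y) - f (h + x)) (c := 0) (R := R / 4)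
      (M := 2 * M / (R / 2) * dist y x) (by positivity)
      (fun h hh => (((hshift h y (hd h hh y hy)).fun_sub
        (hshift h x (hd h hh x hxx))).differentiableWithinAt)) (fun h hh => ?_)
    · rwa [fderiv_fun_sub, fderiv_comp_add_right, fderiv_comp_add_right, zero_add, zero_add] at this
      · exact hshift 0 y (hd 0 h0 y hy)
      · exact hshift 0 x (hd 0 h0 x hxx)
    · have hb : ball (h + x) (R / 2) ⊆ ball x R := by
        refine ball_subset_ball' ?_
        rw [mem_ball_zero_iff] at hh
        rw [dist_eq_norm, add_sub_cancel_right]; linarith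
      rw [← dist_eq_norm, ← dist_add_left h y x]
      refine dist_le_of_norm_le (hf.mono (hb.trans hRs)) (fun z hz => hRM z (hb hz)) ?_
      rw [mem_ball, dist_add_left]
      linarith [mem_ball.1 hy]
  rw [ContinuousAt, tendsto_iff_norm_sub_tendsto_zero]
  refine squeeze_zero' (Eventually.of_forall fun _ => norm_nonneg _)
    (mem_of_superset (ball_mem_nhds x (by positivity)) key) ?_
  have : ContinuousAt (fun y => 2 * (2 * M / (R / 2) * dist y x) / (R / 4)) x := by fun_prop
  simpa [ContinuousAt] using this

theorem hasStrictFDerivAt_of_differentiableOn {f : E → F} {s : Set E}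
    (hs : IsOpen s) (hf : DifferentiableOn ℂ f s) {x : E} (hx : x ∈ s) :
    HasStrictFDerivAt f (fderiv ℂ f x) x :=
  hasStrictFDerivAt_of_hasFDerivAt_of_continuousAt
    (mem_of_superset (hs.mem_nhds hx) fun _ hy =>
      (hf.differentiableAt (hs.mem_nhds hy)).hasFDerivAt)
    (continuousAt_fderiv_of_differentiableOn hs hf hx)

/-- An injective holomorphic map in finite dimension, with everywhere injective derivative, has
open image and a holomorphic inverse. -/
theorem exists_holomorphic_inverse [FiniteDimensional ℂ E] {f : E → E} {s : Set E}
    (hs : IsOpen s) (hf : DifferentiableOn ℂ f s) (hinj : InjOn f s)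
    (hker : ∀ x ∈ s, ∀ v, fderiv ℂ f x v = 0 → v = 0) :
    IsOpen (f '' s) ∧ ∃ g : E → E, DifferentiableOn ℂ g (f '' s) ∧ ∀ x ∈ s, g (f x) = x := by
  have : CompleteSpace E := FiniteDimensional.complete ℂ E
  have hequiv : ∀ x ∈ s, ∃ A : E ≃L[ℂ] E, HasStrictFDerivAt f (A : E →L[ℂ] E) x := by
    intro x hx
    have hi : Function.Injective (fderiv ℂ f x : E →ₗ[ℂ] E) :=
      (injective_iff_map_eq_zero _).2 (hker x hx)
    refine ⟨(LinearEquiv.ofInjectiveEndo _ hi).toContinuousLinearEquiv, ?_⟩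
    convert! hasStrictFDerivAt_of_differentiableOn hs hf hx
  have hopen : ∀ x ∈ s, ∀ t ∈ 𝓝 x, f '' t ∈ 𝓝 (f x) := by
    intro x hx t ht
    obtain ⟨A, hA⟩ := hequiv x hx
    rw [← hA.map_nhds_eq_of_equiv]
    exact image_mem_map ht
  refine ⟨?_, Function.invFunOn f s, ?_, fun x hx => hinj.leftInvOn_invFunOn hx⟩
  · rw [isOpen_iff_mem_nhds]
    rintro _ ⟨x, hx, rfl⟩
    exact hopen x hx s (hs.mem_nhds hx)
  · rintro _ ⟨x, hx, rfl⟩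
    obtain ⟨A, hA⟩ := hequiv x hx
    have hg : Function.invFunOn f s (f x) = x := hinj.leftInvOn_invFunOn hx
    refine (HasFDerivAt.of_local_left_inverse (f' := A) ?_ (hg.symm ▸ hA.hasFDerivAt)
      ?_).differentiableAt.differentiableWithinAt
    · rw [ContinuousAt, hg]
      intro t ht
      refine mem_map.2 <| mem_of_superset (hopen x hx (t ∩ s) (inter_mem ht (hs.mem_nhds hx))) ?_
      rintro _ ⟨y, ⟨hyt, hys⟩, rfl⟩
      rw [mem_preimage, hinj.leftInvOn_invFunOn hys]
      exact hyt
    · filter_upwards [hopen x hx s (hs.mem_nhds hx)] with y hy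
      exact Function.invFunOn_eq hy

end SeveralVariables


/-! ### Extreme points of the Newton polygon. -/

section NewtonPolygon

theorem mem_newtonPolygon {b : ℕ → ℕ → ℂ} {i j : ℕ} (h : b i j ≠ 0) :
    ((i : ℝ), (j : ℝ)) ∈ newtonPolygon b :=
  subset_convexHull ℝ _ ⟨i, j, h, le_rfl, le_rfl⟩

/-- The points all of whose translates by `e ≥ 0` stay in the polygon form a convex set that
contains the generating quadrants. -/
theorem newtonPolygon_upward {b : ℕ → ℕ → ℂ} {v w : ℝ × ℝ} (hv : v ∈ newtonPolygon b)
    (h : v ≤ w) : w ∈ newtonPolygon b := by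
  have key : newtonPolygon b ⊆ {v | ∀ e : ℝ × ℝ, 0 ≤ e → v + e ∈ newtonPolygon b} := by
    refine convexHull_min ?_ ?_
    · rintro v ⟨i, j, hb, h1, h2⟩ e he
      refine subset_convexHull ℝ _ ⟨i, j, hb, ?_, ?_⟩
      · exact h1.trans (le_add_of_nonneg_right he.1)
      · exact h2.trans (le_add_of_nonneg_right he.2)
    · intro x hx y hy s t hs ht hst e he
      have := convex_convexHull ℝ {v | ∃ i j : ℕ, b i j ≠ 0 ∧ v ∈ quadrant i j}
        (hx e he) (hy e he) hs ht hst
      rw [smul_add, smul_add, add_add_add_comm, ← add_smul, hst, one_smul] at this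
      exact this
  simpa using key hv (w - v) (sub_nonneg.2 h)

/-- `v` is the midpoint of `u` and its reflection `v + (v - u)`, which lies in the polygon by upward
closure. -/
theorem eq_of_le_of_mem_extremePoints {b : ℕ → ℕ → ℂ} {u v : ℝ × ℝ}
    (hv : v ∈ (newtonPolygon b).extremePoints ℝ) (hu : u ∈ newtonPolygon b) (h : u ≤ v) :
    u = v := by
  have hw : v + (v - u) ∈ newtonPolygon b :=
    newtonPolygon_upward hv.1 (le_add_of_nonneg_right (sub_nonneg.2 h))
  refine (mem_extremePoints.1 hv).2 u hu _ hw ?_ |>.1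
  refine ⟨1 / 2, 1 / 2, by norm_num, by norm_num, by norm_num, ?_⟩
  rw [← smul_add, add_comm u, add_assoc, sub_add_cancel, ← two_smul ℝ v, smul_smul]
  norm_num

theorem coeff_ne_zero_of_mem_extremePoints {b : ℕ → ℕ → ℂ} {i j : ℕ}
    (h : ((i : ℝ), (j : ℝ)) ∈ (newtonPolygon b).extremePoints ℝ) : b i j ≠ 0 := by
  obtain ⟨i', j', hb, h1, h2⟩ := extremePoints_convexHull_subset h
  have := eq_of_le_of_mem_extremePoints h (mem_newtonPolygon hb) ⟨h1, h2⟩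
  simp only [Prod.mk.injEq, Nat.cast_inj] at this
  rwa [← this.1, ← this.2]

/-- The point of the segment from `u` to `w` with the abscissa of `v` is not above `v`. If `v` were
extreme, it would be that point, hence interior to a nondegenerate segment. -/
theorem not_mem_extremePoints_of_le {b : ℕ → ℕ → ℂ} {u v w : ℝ × ℝ} {c : ℝ} (hc : 0 < c)
    (hu : u ∈ newtonPolygon b) (hw : w ∈ newtonPolygon b) (huv : u.1 < v.1) (hvw : v.1 < w.1)
    (h1 : u.1 + c * u.2 ≤ v.1 + c * v.2) (h2 : w.1 + c * w.2 ≤ v.1 + c * v.2) :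
    v ∉ (newtonPolygon b).extremePoints ℝ := by
  intro hv
  set t := (v.1 - u.1) / (w.1 - u.1) with ht
  have hd : 0 < w.1 - u.1 := by linarith
  have ht0 : 0 < t := div_pos (by linarith) hd
  have ht1 : 0 < 1 - t := by
    rw [ht, sub_pos, div_lt_one hd]; linarith
  have htm : t * (w.1 - u.1) = v.1 - u.1 := div_mul_cancel₀ _ hd.ne'
  have hp : (1 - t) • u + t • w ∈ newtonPolygon b :=
    convex_convexHull ℝ _ hu hw ht1.le ht0.le (by ring)
  have hfst : ((1 - t) • u + t • w).1 = v.1 := by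
    simp only [Prod.fst_add, Prod.smul_fst, smul_eq_mul]; linarith
  have hle : (1 - t) • u + t • w ≤ v := by
    refine ⟨hfst.le, ?_⟩
    simp only [Prod.snd_add, Prod.smul_snd, smul_eq_mul] at *
    simp only [Prod.fst_add, Prod.smul_fst, smul_eq_mul] at *
    have e1 := mul_le_mul_of_nonneg_left h1 ht1.le
    have e2 := mul_le_mul_of_nonneg_left h2 ht0.le
    have : c * ((1 - t) * u.2 + t * w.2) ≤ c * v.2 := by linarith
    exact le_of_mul_le_mul_left this hc
  have heq := eq_of_le_of_mem_extremePoints hv hp hle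
  have := ((mem_extremePoints.1 hv).2 u hu w hw ⟨1 - t, t, ht1, ht0, by ring, heq⟩).1
  rw [this] at huv
  exact lt_irrefl _ huv

/-- The order of ℕ × ℕ is a well-quasi-order (Dickson's lemma), so a monotone real function attains
its minimum on every nonempty subset. -/
theorem exists_isMinOn_of_nonneg {S : Set (ℕ × ℕ)} (hS : S.Nonempty) {α β : ℝ} (hα : 0 ≤ α)
    (hβ : 0 ≤ β) : ∃ v ∈ S, ∀ u ∈ S, α * v.1 + β * v.2 ≤ α * u.1 + β * u.2 := by
  have hmono : Monotone fun v : ℕ × ℕ => α * v.1 + β * v.2 := fun u v h => by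
    have h1 : (u.1 : ℝ) ≤ v.1 := Nat.cast_le.2 h.1
    have h2 : (u.2 : ℝ) ≤ v.2 := Nat.cast_le.2 h.2
    dsimp only
    gcongr
  obtain ⟨v, hv⟩ := IsPWO.exists_minimalFor (fun v : ℕ × ℕ => α * v.1 + β * v.2) S
    ((isPWO_of_wellQuasiOrderedLE S).image_of_monotone hmono) hS
  exact ⟨v, hv.1, fun u hu => (le_total _ _).elim id (hv.2 hu)⟩

/-- A linear functional with nonnegative coefficients attains its minimum over the support at an
extreme point of the Newton polygon. -/
theorem exists_extremePoint_isMinOn {b : ℕ → ℕ → ℂ} {i₀ j₀ : ℕ} (hb : b i₀ j₀ ≠ 0)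
    {α β α' β' : ℝ} (hα : 0 ≤ α) (hβ : 0 ≤ β) (hα' : 0 ≤ α') (hβ' : 0 ≤ β')
    (hdet : α * β' - α' * β ≠ 0) :
    ∃ i j : ℕ, ((i : ℝ), (j : ℝ)) ∈ (newtonPolygon b).extremePoints ℝ ∧
      ∀ i' j' : ℕ, b i' j' ≠ 0 → α * i + β * j ≤ α * i' + β * j' := by
  obtain ⟨v₀, hv₀, hmin₀⟩ := exists_isMinOn_of_nonneg
    (S := {v | b v.1 v.2 ≠ 0}) ⟨(i₀, j₀), hb⟩ hα hβ
  -- The functional `(α', β')` breaks ties among the minimizers of `(α, β)`. The polygon then lies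
  -- in a convex lexicographic half-plane with `v` at its edge, and `v` is extreme because, by
  -- `hdet`, the two values determine it.
  obtain ⟨v, ⟨hv, hvmin⟩, hmin'⟩ := exists_isMinOn_of_nonneg
    (S := {v | b v.1 v.2 ≠ 0 ∧ ∀ u : ℕ × ℕ, b u.1 u.2 ≠ 0 →
      α * v.1 + β * v.2 ≤ α * u.1 + β * u.2}) ⟨v₀, hv₀, hmin₀⟩ hα' hβ'
  set c := α * (v.1 : ℝ) + β * v.2 with hc
  set c' := α' * (v.1 : ℝ) + β' * v.2 with hc'
  have hlex : newtonPolygon b ⊆ {x | c < α * x.1 + β * x.2 ∨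
      (α * x.1 + β * x.2 = c ∧ c' ≤ α' * x.1 + β' * x.2)} := by
    refine convexHull_min ?_ ?_
    · rintro x ⟨i, j, hij, h1, h2⟩
      have e1 : α * i + β * j ≤ α * x.1 + β * x.2 := by gcongr
      have e2 : α' * i + β' * j ≤ α' * x.1 + β' * x.2 := by gcongr
      have e3 := hvmin (i, j) hij
      rcases (e3.trans e1).lt_or_eq with h | h
      · exact Or.inl h
      · refine Or.inr ⟨h.symm, (hmin' (i, j) ⟨hij, fun u hu => ?_⟩).trans e2⟩
        exact (e1.trans h.symm.le).trans (hvmin u hu)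
    · intro x hx y hy s t hs ht hst
      have exp1 : α * (s • x + t • y).1 + β * (s • x + t • y).2 =
          s * (α * x.1 + β * x.2) + t * (α * y.1 + β * y.2) := by
        simp only [Prod.fst_add, Prod.smul_fst, Prod.snd_add, Prod.smul_snd, smul_eq_mul]; ring
      have exp2 : α' * (s • x + t • y).1 + β' * (s • x + t • y).2 =
          s * (α' * x.1 + β' * x.2) + t * (α' * y.1 + β' * y.2) := by
        simp only [Prod.fst_add, Prod.smul_fst, Prod.snd_add, Prod.smul_snd, smul_eq_mul]; ring
      rw [mem_ofPred_eq] at hx hy ⊢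
      rw [exp1, exp2]
      rcases hs.eq_or_lt with rfl | hs
      · rw [zero_add] at hst; subst hst; simpa using hy
      rcases ht.eq_or_lt with rfl | ht
      · rw [add_zero] at hst; subst hst; simpa using hx
      have hcs : c = s * c + t * c := by rw [← add_mul, hst, one_mul]
      have hcs' : c' = s * c' + t * c' := by rw [← add_mul, hst, one_mul]
      rcases hx with hx | ⟨hx, hx'⟩
      · left
        have e1 := mul_lt_mul_of_pos_left hx hs
        have e2 : t * c ≤ t * (α * y.1 + β * y.2) :=
          mul_le_mul_of_nonneg_left (hy.elim le_of_lt fun h => h.1.ge) ht.le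
        linarith
      · rcases hy with hy | ⟨hy, hy'⟩
        · left
          have e1 := mul_lt_mul_of_pos_left hy ht
          rw [hx]; linarith
        · right
          refine ⟨by rw [hx, hy, ← hcs], ?_⟩
          have e1 := mul_le_mul_of_nonneg_left hx' hs.le
          have e2 := mul_le_mul_of_nonneg_left hy' ht.le
          linarith
  refine ⟨v.1, v.2, mem_extremePoints.2 ⟨mem_newtonPolygon hv, ?_⟩,
    fun i' j' h => hvmin (i', j') h⟩
  rintro x hx y hy ⟨s, t, hs, ht, hst, hxy⟩
  have h1 : s * x.1 + t * y.1 = v.1 := congrArg Prod.fst hxy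
  have h2 : s * x.2 + t * y.2 = v.2 := congrArg Prod.snd hxy
  have hgc : s * (α * x.1 + β * x.2) + t * (α * y.1 + β * y.2) = s * c + t * c := by
    rw [← add_mul, hst, one_mul, hc, ← h1, ← h2]; ring
  have hgc' : s * (α' * x.1 + β' * x.2) + t * (α' * y.1 + β' * y.2) = s * c' + t * c' := by
    rw [← add_mul, hst, one_mul, hc', ← h1, ← h2]; ring
  have hx1 : c ≤ α * x.1 + β * x.2 := (hlex hx).elim le_of_lt fun h => h.1.ge
  have hy1 : c ≤ α * y.1 + β * y.2 := (hlex hy).elim le_of_lt fun h => h.1.ge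
  have hxc : α * x.1 + β * x.2 = c := by
    refine le_antisymm (le_of_mul_le_mul_left ?_ hs) hx1
    linarith [mul_le_mul_of_nonneg_left hy1 ht.le]
  have hyc : α * y.1 + β * y.2 = c := by
    refine le_antisymm (le_of_mul_le_mul_left ?_ ht) hy1
    linarith [mul_le_mul_of_nonneg_left hx1 hs.le]
  have hx2 : c' ≤ α' * x.1 + β' * x.2 := (hlex hx).elim (fun h => absurd hxc h.ne') fun h => h.2
  have hy2 : c' ≤ α' * y.1 + β' * y.2 := (hlex hy).elim (fun h => absurd hyc h.ne') fun h => h.2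
  have hxc' : α' * x.1 + β' * x.2 = c' := by
    refine le_antisymm (le_of_mul_le_mul_left ?_ hs) hx2
    linarith [mul_le_mul_of_nonneg_left hy2 ht.le]
  have hyc' : α' * y.1 + β' * y.2 = c' := by
    refine le_antisymm (le_of_mul_le_mul_left ?_ ht) hy2
    linarith [mul_le_mul_of_nonneg_left hx2 hs.le]
  have huniq : ∀ z : ℝ × ℝ, α * z.1 + β * z.2 = c → α' * z.1 + β' * z.2 = c' →
      z = ((v.1 : ℝ), (v.2 : ℝ)) := by
    intro z h h'
    have e1 : (α * β' - α' * β) * (z.1 - v.1) = 0 := by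
      linear_combination β' * (h.trans hc) - β * (h'.trans hc')
    have e2 : (α * β' - α' * β) * (z.2 - v.2) = 0 := by
      linear_combination α * (h'.trans hc') - α' * (h.trans hc)
    exact Prod.ext (sub_eq_zero.1 ((mul_eq_zero.1 e1).resolve_left hdet))
      (sub_eq_zero.1 ((mul_eq_zero.1 e2).resolve_left hdet))
  exact ⟨huniq x hxc hxc', huniq y hyc hyc'⟩

end NewtonPolygon


/-! ### From the four cases to numerical inequalities on the exponents and weights. -/

/-- The exponents `(A, B)` of the (Laurent) monomials that are bounded on the wedges. -/
def InCone (l₁ L : ℝ) (A B : ℤ) : Prop :=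
  0 ≤ (A : ℝ) + l₁ * B ∧ 0 ≤ L * (A + l₁ * B) + B

/-- The numerical properties of the dominant exponent and of the weights. -/
structure IsAdmissible (l₁ L : ℝ) (δ γ d : ℕ) (b : ℕ → ℕ → ℂ) : Prop where
  l₁_nonneg : 0 ≤ l₁
  L_nonneg : 0 ≤ L
  two_le_δ : 2 ≤ δ
  two_le_d : 2 ≤ d
  coeff_ne : b γ d ≠ 0
  supp : ∀ i j, b i j ≠ 0 → InCone l₁ L ((i : ℤ) - γ) ((j : ℤ) - d)
  -- With M = γ + l₁ d - l₁ δ, the linear part of f₀ in logarithmic coordinates is σ' = Mτ + (LM +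
  -- d)σ and τ' = (δ - LM)τ + L(δ - LM - d)σ. The last three fields say that M ≥ 0, that the
  -- diagonal entry of τ is at least 2 and that the remaining off-diagonal entry is nonnegative.
  tilt_nonneg : 0 ≤ (γ : ℝ) + l₁ * d - l₁ * δ
  two_le_sub : 2 ≤ (δ : ℝ) - L * (γ + l₁ * d - l₁ * δ)
  excess_nonneg : 0 ≤ L * (δ - L * (γ + l₁ * d - l₁ * δ) - d)

section Vertices

variable {b : ℕ → ℕ → ℂ} {s : ℕ} {n m : ℕ → ℕ}

theorem IsVertexList.mem_extremePoints (h : IsVertexList b s n m) {k : ℕ} (h1 : 1 ≤ k)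
    (h2 : k ≤ s) : ((n k : ℝ), (m k : ℝ)) ∈ (newtonPolygon b).extremePoints ℝ := by
  rw [h.vertices]; exact ⟨k, h1, h2, rfl⟩

theorem IsVertexList.exists_vertex_isMinOn (h : IsVertexList b s n m) {i j : ℕ} (hb : b i j ≠ 0)
    {α β α' β' : ℝ} (hα : 0 ≤ α) (hβ : 0 ≤ β) (hα' : 0 ≤ α') (hβ' : 0 ≤ β')
    (hdet : α * β' - α' * β ≠ 0) :
    ∃ k, 1 ≤ k ∧ k ≤ s ∧ ∀ i' j' : ℕ, b i' j' ≠ 0 → α * n k + β * m k ≤ α * i' + β * j' := by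
  obtain ⟨i, j, hij, hmin⟩ := exists_extremePoint_isMinOn hb hα hβ hα' hβ' hdet
  rw [h.vertices] at hij
  obtain ⟨k, h1, h2, h3⟩ := hij
  simp only [Prod.mk.injEq] at h3
  rw [h3.1, h3.2] at hmin
  exact ⟨k, h1, h2, hmin⟩

theorem IsVertexList.m_le (h : IsVertexList b s n m) {i j : ℕ} (hb : b i j ≠ 0) : m s ≤ j := by
  obtain ⟨k, h1, h2, hk⟩ := h.exists_vertex_isMinOn hb (α := 0) (β := 1) (α' := 1) (β' := 0)
    le_rfl zero_le_one zero_le_one le_rfl (by norm_num)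
  have := hk i j hb
  simp only [zero_mul, one_mul, zero_add, Nat.cast_le] at this
  exact (h.strictAnti.antitoneOn ⟨h1, h2⟩ ⟨h1.trans h2, le_rfl⟩ h2).trans this

theorem IsVertexList.n_le (h : IsVertexList b s n m) {i j : ℕ} (hb : b i j ≠ 0) : n 1 ≤ i := by
  obtain ⟨k, h1, h2, hk⟩ := h.exists_vertex_isMinOn hb (α := 1) (β := 0) (α' := 0) (β' := 1)
    zero_le_one le_rfl le_rfl zero_le_one (by norm_num)
  have := hk i j hb
  simp only [zero_mul, one_mul, add_zero, Nat.cast_le] at this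
  exact (h.strictMono.monotoneOn ⟨le_rfl, h1.trans h2⟩ ⟨h1, h2⟩ h1).trans this

theorem IsVertexList.n_lt (h : IsVertexList b s n m) {k l : ℕ} (h1 : 1 ≤ k) (hkl : k < l)
    (h2 : l ≤ s) : (n k : ℝ) < n l :=
  Nat.cast_lt.2 (h.strictMono ⟨h1, by omega⟩ ⟨by omega, h2⟩ hkl)

theorem IsVertexList.m_lt (h : IsVertexList b s n m) {k l : ℕ} (h1 : 1 ≤ k) (hkl : k < l)
    (h2 : l ≤ s) : (m l : ℝ) < m k :=
  Nat.cast_lt.2 (h.strictAnti ⟨h1, by omega⟩ ⟨by omega, h2⟩ hkl)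

theorem IsVertexList.invSlope_pos (h : IsVertexList b s n m) {k : ℕ} (h1 : 1 ≤ k)
    (h2 : k + 1 ≤ s) : 0 < invSlope n m k :=
  div_pos (sub_pos.2 (h.n_lt h1 k.lt_succ_self h2)) (sub_pos.2 (h.m_lt h1 k.lt_succ_self h2))

theorem IsVertexList.invSlope_mul (h : IsVertexList b s n m) {k : ℕ} (h1 : 1 ≤ k)
    (h2 : k + 1 ≤ s) :
    invSlope n m k * ((m k : ℝ) - m (k + 1)) = (n (k + 1) : ℝ) - n k :=
  div_mul_cancel₀ _ (sub_pos.2 (h.m_lt h1 k.lt_succ_self h2)).ne'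

theorem IsVertexList.mem_newtonPolygon (h : IsVertexList b s n m) {k : ℕ} (h1 : 1 ≤ k)
    (h2 : k ≤ s) : ((n k : ℝ), (m k : ℝ)) ∈ newtonPolygon b :=
  (h.mem_extremePoints h1 h2).1

/-- The line through two consecutive vertices supports the Newton polygon. -/
theorem IsVertexList.supporting_line (h : IsVertexList b s n m) {k : ℕ} (h1 : 1 ≤ k)
    (h2 : k + 1 ≤ s) {i j : ℕ} (hb : b i j ≠ 0) :
    (n k : ℝ) + invSlope n m k * m k ≤ i + invSlope n m k * j := by
  have hc := h.invSlope_pos h1 h2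
  have hl := h.invSlope_mul h1 h2
  set c := invSlope n m k
  obtain ⟨l, hl1, hl2, hmin⟩ := h.exists_vertex_isMinOn hb (α := 1) (β := c) (α' := 1) (β' := 0)
    zero_le_one hc.le zero_le_one le_rfl (by simp [hc.ne'])
  simp only [one_mul] at hmin
  refine le_trans ?_ (hmin i j hb)
  by_contra! hlt
  -- If a vertex `l` lay strictly below the line, then vertex `k` (for `l < k`) or `k + 1` (for `l >
  -- k + 1`) would not be below a chord between two others, so it would not be extreme.
  rcases lt_trichotomy l k with hk | rfl | hk
  · refine not_mem_extremePoints_of_le hc (h.mem_newtonPolygon hl1 hl2)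
      (h.mem_newtonPolygon (by omega) h2) (h.n_lt hl1 hk (by omega)) (h.n_lt h1 k.lt_succ_self h2)
      hlt.le ?_ (h.mem_extremePoints h1 (by omega))
    linarith
  · exact lt_irrefl _ hlt
  · rcases (Nat.succ_le_of_lt hk).eq_or_lt with rfl | hk
    · rw [Nat.succ_eq_add_one] at hlt
      linarith
    · refine not_mem_extremePoints_of_le hc (h.mem_newtonPolygon h1 (by omega))
        (h.mem_newtonPolygon hl1 hl2) (h.n_lt h1 k.lt_succ_self h2) (h.n_lt (by omega) hk hl2)
        ?_ ?_ (h.mem_extremePoints (by omega) h2)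
      · linarith
      · linarith

/-- Otherwise the middle one of three consecutive vertices would be on or above the chord of its
neighbours. -/
theorem IsVertexList.invSlope_lt (h : IsVertexList b s n m) {k : ℕ} (h1 : 1 ≤ k)
    (h2 : k + 2 ≤ s) : invSlope n m k < invSlope n m (k + 1) := by
  by_contra! hle
  have hc := h.invSlope_pos (k := k + 1) (by omega) h2
  have e1 := h.invSlope_mul h1 (by omega)
  have e2 := h.invSlope_mul (k := k + 1) (by omega) h2
  have e3 := mul_le_mul_of_nonneg_right hle
    (sub_pos.2 (h.m_lt h1 k.lt_succ_self (by omega))).le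
  simp only [Nat.succ_eq_add_one] at e3
  refine not_mem_extremePoints_of_le hc (h.mem_newtonPolygon h1 (by omega))
    (h.mem_newtonPolygon (by omega) h2) (h.n_lt h1 k.lt_succ_self (by omega))
    (h.n_lt (by omega) (k + 1).lt_succ_self h2) ?_ ?_ (h.mem_extremePoints (by omega) (by omega))
  · simp only [Nat.succ_eq_add_one]; linarith
  · simp only [Nat.succ_eq_add_one]; linarith

/-- Multiplied by the positive `invSlope`, a comparison of δ with T_k becomes an inequality linear
in the vertex. -/
theorem IsVertexList.invSlope_mul_yIntercept (h : IsVertexList b s n m) {k : ℕ} (h1 : 1 ≤ k)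
    (h2 : k + 1 ≤ s) :
    invSlope n m k * yIntercept n m k = n k + invSlope n m k * m k := by
  have e1 := (sub_pos.2 (h.m_lt h1 k.lt_succ_self h2)).ne'
  have e2 := (sub_pos.2 (h.n_lt h1 k.lt_succ_self h2)).ne'
  simp only [Nat.succ_eq_add_one] at e1 e2
  rw [yIntercept, invSlope]
  field_simp
  ring

/-- The cone condition comes from the supporting lines at the dominant vertex, or from `n_le` and
`m_le` on a side without such a line. In cases 2 and 4 the upper bound on δ gives `tilt_nonneg`. In
cases 3 and 4 the lower bound gives δ - LM ≥ d, whence `two_le_sub` because d ≥ 2. -/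
theorem IsDominant.isAdmissible {δ γ d : ℕ} {l₁ L : ℝ} (h : IsVertexList b s n m)
    (hdom : IsDominant δ s n m γ d l₁ L) (hδ : 2 ≤ δ) (hd : 2 ≤ d) :
    IsAdmissible l₁ L δ γ d b := by
  have hδ' : (2 : ℝ) ≤ δ := by exact_mod_cast hδ
  have hd' : (2 : ℝ) ≤ d := by exact_mod_cast hd
  cases hdom with
  | case1 hs =>
    subst hs
    refine ⟨le_rfl, le_rfl, hδ, hd, coeff_ne_zero_of_mem_extremePoints
      (h.mem_extremePoints le_rfl le_rfl), fun i j hb => ?_, by simp, by simpa, by simp⟩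
    have e1 : (n 1 : ℝ) ≤ i := Nat.cast_le.2 (h.n_le hb)
    have e2 : (m 1 : ℝ) ≤ j := Nat.cast_le.2 (h.m_le hb)
    constructor <;> push_cast <;> linarith
  | case2 hs hT =>
    obtain ⟨k, rfl⟩ : ∃ k, s = k + 1 := ⟨s - 1, by omega⟩
    simp only [Nat.add_sub_cancel] at hT ⊢
    have hk : 1 ≤ k := by omega
    have hc := h.invSlope_pos hk le_rfl
    have e1 := h.invSlope_mul hk le_rfl
    have e2 := h.invSlope_mul_yIntercept hk le_rfl
    have e3 := mul_le_mul_of_nonneg_left hT hc.le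
    refine ⟨hc.le, le_rfl, hδ, hd, coeff_ne_zero_of_mem_extremePoints
      (h.mem_extremePoints (by omega) le_rfl), fun i j hb => ?_, by linarith, by simpa, by simp⟩
    have e4 := h.supporting_line hk le_rfl hb
    have e5 : (m (k + 1) : ℝ) ≤ j := Nat.cast_le.2 (h.m_le hb)
    constructor <;> push_cast <;> linarith
  | case3 hs hT =>
    have hc := h.invSlope_pos le_rfl hs
    have e2 := h.invSlope_mul_yIntercept le_rfl hs
    have e3 := mul_le_mul_of_nonneg_left hT hc.le
    set c := invSlope n m 1
    have hci : c⁻¹ * c = 1 := inv_mul_cancel₀ hc.ne'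
    have e4 : 0 ≤ (δ : ℝ) - c⁻¹ * n 1 - m 1 := by
      refine le_of_mul_le_mul_left ?_ hc
      linear_combination e3 - e2 + (n 1 : ℝ) * hci
    refine ⟨le_rfl, (inv_pos.2 hc).le, hδ, hd, coeff_ne_zero_of_mem_extremePoints
      (h.mem_extremePoints le_rfl hs.le), fun i j hb => ⟨?_, ?_⟩, by simp, ?_, ?_⟩
    · have := h.n_le hb
      push_cast
      rw [zero_mul, add_zero, sub_nonneg]
      exact_mod_cast this
    · have e5 := h.supporting_line le_rfl hs hb
      push_cast
      refine le_of_mul_le_mul_left ?_ hc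
      linear_combination e5 - (i - n 1 : ℝ) * hci
    · simp only [zero_mul, add_zero, sub_zero]; linarith
    · simp only [zero_mul, add_zero, sub_zero]
      exact mul_nonneg (inv_pos.2 hc).le e4
  | case4 k hk hks hT hT' l₁ l₂ h₁ h₂ =>
    obtain ⟨k, rfl⟩ : ∃ k', k = k' + 1 := ⟨k - 1, by omega⟩
    simp only [Nat.add_sub_cancel] at hT' h₁ ⊢
    have hk : 1 ≤ k := by omega
    have hks : k + 2 ≤ s := by omega
    have hlt := h.invSlope_lt hk hks
    have hc := h.invSlope_pos hk (by omega)
    have e1 := h.invSlope_mul hk (by omega)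
    have e2 := h.invSlope_mul_yIntercept hk (by omega)
    have e2' := h.invSlope_mul_yIntercept (k := k + 1) (by omega) hks
    have e3' := mul_le_mul_of_nonneg_left hT (hc.trans hlt).le
    have e3 := mul_le_mul_of_nonneg_left hT' hc.le
    have s1 : ∀ {i j : ℕ}, b i j ≠ 0 → _ := fun hb => h.supporting_line hk (by omega) hb
    have s2 : ∀ {i j : ℕ}, b i j ≠ 0 → _ := fun hb =>
      h.supporting_line (k := k + 1) (by omega) hks hb
    rw [← h₁] at hlt hc e1 e2 e3 s1
    rw [← h₂] at hlt e2' e3' s2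
    have hl₂ : 0 < l₂ := by linarith
    have hli : l₂⁻¹ * l₂ = 1 := inv_mul_cancel₀ hl₂.ne'
    -- Multiplied by l₂, the right side is (l₁ + l₂)(δ - T_k).
    have e4 : 0 ≤ (δ : ℝ) - l₂⁻¹ * (n (k + 1) + l₁ * m (k + 1) - l₁ * δ) - m (k + 1) := by
      refine le_of_mul_le_mul_left ?_ hl₂
      linear_combination e3' - e2' + (n (k + 1) + l₁ * m (k + 1) - l₁ * δ : ℝ) * hli
    refine ⟨hc.le, (inv_pos.2 hl₂).le, hδ, hd, coeff_ne_zero_of_mem_extremePoints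
      (h.mem_extremePoints (by omega) (by omega)), fun i j hb => ⟨?_, ?_⟩, by linarith,
      by linarith, mul_nonneg (inv_pos.2 hl₂).le e4⟩
    · have := s1 hb
      push_cast
      linarith
    · have := s2 hb
      push_cast
      refine le_of_mul_le_mul_left ?_ hl₂
      linear_combination this - (i - n (k + 1) + l₁ * (j - m (k + 1)) : ℝ) * hli

end Vertices

/-- δ = 0 contradicts p(0) = 0. For δ = 1 the triangular derivative at 0 has the eigenvalue `a ≠ 0`;
the eigenvector depends on whether ∂q/∂w(0) equals `a`. -/
theorem two_le_of_isSuperattracting {p : ℂ → ℂ} {q : ℂ × ℂ → ℂ} {a : ℂ} {δ : ℕ}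
    (hp : AnalyticAt ℂ p 0) (hq : AnalyticAt ℂ q 0) (hsuper : IsSuperattracting (skew p q))
    (ha : a ≠ 0) (hpa : (fun z : ℂ => p z - a * z ^ δ) =O[𝓝 0] (fun z : ℂ => z ^ (δ + 1))) :
    2 ≤ δ := by
  have hp0 : p 0 = 0 := congrArg Prod.fst hsuper.1
  by_contra! hlt
  interval_cases δ
  · have := hpa.trans_tendsto (by simpa using! (continuous_pow 1).tendsto (0 : ℂ))
    have h2 : Tendsto (fun z : ℂ => p z - a * z ^ 0) (𝓝 0) (𝓝 (p 0 - a * 0 ^ 0)) :=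
      (hp.continuousAt.sub (by fun_prop)).tendsto
    simpa [hp0, ha] using tendsto_nhds_unique this h2
  · have hpd : HasDerivAt p a 0 := by
      rw [hasDerivAt_iff_isLittleO]
      have := hpa.trans_isLittleO (Asymptotics.isLittleO_pow_id (𝕜 := ℂ) one_lt_two)
      simpa [hp0, mul_comm] using this
    have hqd := hq.differentiableAt.hasFDerivAt
    set Q := fderiv ℂ q 0
    have hfd : HasFDerivAt (skew p q) ((a • ContinuousLinearMap.fst ℂ ℂ ℂ).prod Q) 0 := by
      refine HasFDerivAt.prodMk ?_ hqd
      exact HasDerivAt.comp_hasFDerivAt (h₂ := p) (0 : ℂ × ℂ) hpd hasFDerivAt_fst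
    refine ha (hsuper.2 a ?_)
    rw [hfd.fderiv]
    by_cases hQ : Q (0, 1) = a
    · refine Module.End.hasEigenvalue_of_hasEigenvector (x := ((0 : ℂ), (1 : ℂ)))
        ⟨Module.End.mem_eigenspace_iff.2 ?_, by simp⟩
      simp [hQ]
    · have hQ' : a - Q (0, 1) ≠ 0 := sub_ne_zero.2 (Ne.symm hQ)
      refine Module.End.hasEigenvalue_of_hasEigenvector
        (x := ((1 : ℂ), Q (1, 0) / (a - Q (0, 1)))) ⟨Module.End.mem_eigenspace_iff.2 ?_, by simp⟩
      have : ((1 : ℂ), Q (1, 0) / (a - Q (0, 1))) =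
        (1, 0) + (Q (1, 0) / (a - Q (0, 1))) • ((0 : ℂ), (1 : ℂ)) := by simp
      simp only [ContinuousLinearMap.coe_coe, ContinuousLinearMap.prod_apply, Prod.smul_mk,
        Prod.mk.injEq]
      refine ⟨by simp, ?_⟩
      rw [this, map_add, map_smul, smul_eq_mul, smul_eq_mul]
      field_simp
      ring


/-! ### Wedges in logarithmic coordinates and bounds for Laurent monomials. -/

section Wedge

variable {l₁ L r r' : ℝ} {x : ℂ × ℂ}

theorem isOpen_wedge (hl : 0 ≤ l₁) (hL : 0 ≤ L) : IsOpen (wedge l₁ L r) := by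
  have h0 : 0 ≤ l₁ * L + 1 := by positivity
  refine IsOpen.and (isOpen_lt ?_ ?_) (isOpen_lt ?_ ?_)
  · exact (Real.continuous_rpow_const h0).comp (by fun_prop)
  · exact ((Real.continuous_rpow_const hL).comp (by fun_prop)).const_mul r
  · fun_prop
  · exact ((Real.continuous_rpow_const hl).comp (by fun_prop)).const_mul r

theorem wedge_mono (h : r ≤ r') : wedge l₁ L r ⊆ wedge l₁ L r' := fun _ hx =>
  ⟨hx.1.trans_le (by gcongr), hx.2.trans_le (by gcongr)⟩

theorem pos_of_mem_wedge (hx : x ∈ wedge l₁ L r) : 0 < r := by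
  by_contra! h
  have h1 : r * ‖x.1‖ ^ l₁ ≤ 0 := mul_nonpos_of_nonpos_of_nonneg h (by positivity)
  linarith [hx.2, norm_nonneg x.2]

/-- If `l₁ ≠ 0`, the second inequality would read ‖w‖ < 0. Points on the axes need separate
treatment, as logarithmic coordinates fail there; this lemma and the next say that they occur only
for a vanishing weight. -/
theorem eq_zero_of_mem_wedge_of_fst (hx : x ∈ wedge l₁ L r) (h : x.1 = 0) : l₁ = 0 := by
  by_contra hl
  have := hx.2
  rw [h, norm_zero, Real.zero_rpow hl, mul_zero] at this
  exact absurd this (norm_nonneg _).not_gt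

theorem eq_zero_of_mem_wedge_of_snd (hx : x ∈ wedge l₁ L r) (h : x.2 = 0) : L = 0 := by
  by_contra hl
  have := hx.1
  rw [h, norm_zero, Real.zero_rpow hl, mul_zero] at this
  exact this.not_ge (by positivity)

theorem norm_snd_lt_of_fst (hx : x ∈ wedge l₁ L r) (h : x.1 = 0) : ‖x.2‖ < r := by
  have := hx.2
  rwa [eq_zero_of_mem_wedge_of_fst hx h, Real.rpow_zero, mul_one] at this

theorem norm_fst_lt_of_snd (hx : x ∈ wedge l₁ L r) (h : x.2 = 0) : ‖x.1‖ < r := by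
  have := hx.1
  rwa [eq_zero_of_mem_wedge_of_snd hx h, Real.rpow_zero, mul_one, mul_zero, zero_add,
    Real.rpow_one] at this

/-- Off the axes the wedge is the quadrant τ, σ < log r. -/
theorem mem_wedge_iff_log (hr : 0 < r) (h1 : x.1 ≠ 0) (h2 : x.2 ≠ 0) :
    x ∈ wedge l₁ L r ↔
      Real.log ‖x.1‖ - L * (Real.log ‖x.2‖ - l₁ * Real.log ‖x.1‖) < Real.log r ∧
      Real.log ‖x.2‖ - l₁ * Real.log ‖x.1‖ < Real.log r := by
  have h1' := norm_pos_iff.2 h1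
  have h2' := norm_pos_iff.2 h2
  refine and_congr ?_ ?_
  · rw [← Real.log_lt_log_iff (by positivity) (by positivity), Real.log_rpow h1',
      Real.log_mul hr.ne' (by positivity), Real.log_rpow h2']
    constructor <;> intro h <;> linarith
  · rw [← Real.log_lt_log_iff (by positivity) (by positivity),
      Real.log_mul hr.ne' (by positivity), Real.log_rpow h1']
    constructor <;> intro h <;> linarith

theorem norm_fst_lt (hL : 0 ≤ L) (hr : r ≤ 1) (hx : x ∈ wedge l₁ L r) : ‖x.1‖ < r := by
  have hr0 := pos_of_mem_wedge hx
  by_cases h1 : x.1 = 0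
  · rwa [h1, norm_zero]
  by_cases h2 : x.2 = 0
  · exact norm_fst_lt_of_snd hx h2
  have h1' := norm_pos_iff.2 h1
  have := (mem_wedge_iff_log hr0 h1 h2).1 hx
  rw [← Real.log_lt_log_iff h1' hr0]
  have h3 : L * (Real.log ‖x.2‖ - l₁ * Real.log ‖x.1‖) ≤ 0 :=
    mul_nonpos_of_nonneg_of_nonpos hL (this.2.le.trans (Real.log_nonpos hr0.le hr))
  linarith

theorem norm_snd_lt (hl : 0 ≤ l₁) (hL : 0 ≤ L) (hr : r ≤ 1) (hx : x ∈ wedge l₁ L r) :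
    ‖x.2‖ < r := by
  refine hx.2.trans_le (mul_le_of_le_one_right (pos_of_mem_wedge hx).le ?_)
  exact Real.rpow_le_one (norm_nonneg _) ((norm_fst_lt hL hr hx).le.trans hr) hl

/-- The Laurent monomial `z ^ A * w ^ B`. -/
noncomputable def laurent (A B : ℤ) (x : ℂ × ℂ) : ℂ := x.1 ^ A * x.2 ^ B

/-- The order of the Laurent monomial `z ^ A * w ^ B` on the wedges. -/
def weight (l₁ L : ℝ) (A B : ℤ) : ℝ := ((A : ℝ) + l₁ * B) + (L * (A + l₁ * B) + B)

variable {A B : ℤ}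

theorem InCone.weight_nonneg (h : InCone l₁ L A B) : 0 ≤ weight l₁ L A B := add_nonneg h.1 h.2

theorem InCone.weight_pos (h : InCone l₁ L A B) (hne : ¬ (A = 0 ∧ B = 0)) :
    0 < weight l₁ L A B := by
  refine h.weight_nonneg.lt_of_ne fun h0 => hne ?_
  have h1 : (A : ℝ) + l₁ * B = 0 := by
    linarith [h.1, h.2, show _ + _ = weight l₁ L A B from rfl]
  have h2 : (B : ℝ) = 0 := by
    have := h0
    rw [weight, h1] at this; linarith
  rw [h2, mul_zero, add_zero] at h1
  exact ⟨by exact_mod_cast h1, by exact_mod_cast h2⟩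

theorem InCone.fst_nonneg (h : InCone l₁ L A B) (hl : l₁ = 0) : 0 ≤ A := by
  have := h.1
  rw [hl, zero_mul, add_zero] at this
  exact_mod_cast this

theorem InCone.snd_nonneg (h : InCone l₁ L A B) (hL : L = 0) : 0 ≤ B := by
  have := h.2
  rw [hL, zero_mul, zero_add] at this
  exact_mod_cast this

/-- The logarithm of the left side is (A + l₁B)τ + (L(A + l₁B) + B)σ, with both coefficients
nonnegative on the cone. On an axis in the wedge the exponent of the vanishing coordinate is
nonnegative. -/
theorem norm_laurent_le (h : InCone l₁ L A B) (hx : x ∈ wedge l₁ L r) :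
    ‖laurent A B x‖ ≤ r ^ weight l₁ L A B := by
  have hr := pos_of_mem_wedge hx
  rw [laurent, norm_mul, norm_zpow, norm_zpow]
  by_cases h1 : x.1 = 0
  · have hl := eq_zero_of_mem_wedge_of_fst hx h1
    rcases (h.fst_nonneg hl).eq_or_lt with hA | hA
    · subst hA
      have hB : (0 : ℝ) ≤ B := by simpa [hl] using h.2
      lift B to ℕ using by exact_mod_cast hB
      have : weight l₁ L 0 B = B := by simp [weight, hl]
      rw [this, zpow_zero, one_mul, zpow_natCast, Real.rpow_natCast]
      exact pow_le_pow_left₀ (norm_nonneg _) (norm_snd_lt_of_fst hx h1).le _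
    · rw [h1, norm_zero, zero_zpow _ hA.ne', zero_mul]
      positivity
  by_cases h2 : x.2 = 0
  · have hL := eq_zero_of_mem_wedge_of_snd hx h2
    rcases (h.snd_nonneg hL).eq_or_lt with hB | hB
    · subst hB
      have hA : (0 : ℝ) ≤ A := by simpa using h.1
      lift A to ℕ using by exact_mod_cast hA
      have : weight l₁ L A 0 = A := by simp [weight, hL]
      rw [this, zpow_zero, mul_one, zpow_natCast, Real.rpow_natCast]
      exact pow_le_pow_left₀ (norm_nonneg _) (norm_fst_lt_of_snd hx h2).le _
    · rw [h2, norm_zero, zero_zpow _ hB.ne', mul_zero]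
      positivity
  have h1' := norm_pos_iff.2 h1
  have h2' := norm_pos_iff.2 h2
  have hlog := (mem_wedge_iff_log hr h1 h2).1 hx
  rw [← Real.log_le_log_iff (by positivity) (by positivity), Real.log_mul (by positivity)
    (by positivity), Real.log_zpow, Real.log_zpow, Real.log_rpow hr, weight]
  have e1 := mul_le_mul_of_nonneg_left hlog.1.le h.1
  have e2 := mul_le_mul_of_nonneg_left hlog.2.le h.2
  linarith

theorem differentiableAt_laurent (h : InCone l₁ L A B) (hx : x ∈ wedge l₁ L r) :
    DifferentiableAt ℂ (laurent A B) x := by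
  have h1 : x.1 ≠ 0 ∨ 0 ≤ A := by
    by_contra! hc
    exact hc.2.not_ge (h.fst_nonneg (eq_zero_of_mem_wedge_of_fst hx hc.1))
  have h2 : x.2 ≠ 0 ∨ 0 ≤ B := by
    by_contra! hc
    exact hc.2.not_ge (h.snd_nonneg (eq_zero_of_mem_wedge_of_snd hx hc.1))
  exact (differentiableAt_fst.zpow h1).mul (differentiableAt_snd.zpow h2)

end Wedge

/-! ### The relative error of the dominant term of q. -/

section Expansion

variable {b : ℕ → ℕ → ℂ} {δ γ d : ℕ} {l₁ L : ℝ}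

/-- The coefficients of `q (z, w) / (b γ d * z ^ γ * w ^ d) - 1` as a Laurent series. -/
noncomputable def relCoeff (b : ℕ → ℕ → ℂ) (γ d : ℕ) (ij : ℕ × ℕ) : ℂ :=
  if ij = (γ, d) then 0 else b ij.1 ij.2 / b γ d

/-- The relative error of the dominant term `b γ d * z ^ γ * w ^ d` of `q`. -/
noncomputable def relError (b : ℕ → ℕ → ℂ) (γ d : ℕ) (x : ℂ × ℂ) : ℂ :=
  ∑' ij : ℕ × ℕ, relCoeff b γ d ij * laurent ((ij.1 : ℤ) - γ) ((ij.2 : ℤ) - d) x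

theorem IsAdmissible.inCone (h : IsAdmissible l₁ L δ γ d b) {ij : ℕ × ℕ}
    (hc : relCoeff b γ d ij ≠ 0) :
    InCone l₁ L ((ij.1 : ℤ) - γ) ((ij.2 : ℤ) - d) ∧
      0 < weight l₁ L ((ij.1 : ℤ) - γ) ((ij.2 : ℤ) - d) := by
  rw [relCoeff] at hc
  split_ifs at hc with h0
  · exact absurd rfl hc
  have hb : b ij.1 ij.2 ≠ 0 := fun h => hc (by rw [h, zero_div])
  have hcone := h.supp _ _ hb
  refine ⟨hcone, hcone.weight_pos fun h' => h0 ?_⟩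
  exact Prod.ext (by omega) (by omega)

/-- By convention `0 ^ k = 0` also for negative `k`, so all terms vanish. This value lets the origin
be adjoined to the wedges below. -/
theorem relError_zero (b : ℕ → ℕ → ℂ) (γ d : ℕ) : relError b γ d 0 = 0 := by
  rw [relError]
  convert tsum_zero with ij
  by_cases h : ij = (γ, d)
  · simp [relCoeff, h]
  · have : (ij.1 : ℤ) - γ ≠ 0 ∨ (ij.2 : ℤ) - d ≠ 0 := by
      by_contra! h'
      exact h (Prod.ext (by omega) (by omega))
    rcases this with h' | h' <;> simp [laurent, zero_zpow _ h']

/-- The majorant of `relError` on the wedge of size `ρ`. -/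
def HasMajorant (l₁ L : ℝ) (γ d : ℕ) (b : ℕ → ℕ → ℂ) (ρ : ℝ) : Prop :=
  Summable fun ij : ℕ × ℕ =>
    ‖relCoeff b γ d ij‖ * ρ ^ weight l₁ L ((ij.1 : ℤ) - γ) ((ij.2 : ℤ) - d)

/-- The point of evaluation is the corner τ = σ = log ρ of the wedge. There z^A w^B equals ρ to the
power `weight`, so the majorant is controlled by the absolute series of q at the corner, divided by
the dominant monomial. -/
theorem hasMajorant_of_summable {ρ : ℝ} (hρ : 0 < ρ)
    (hs : Summable fun ij : ℕ × ℕ =>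
      b ij.1 ij.2 * ((ρ ^ (1 + L) : ℝ) : ℂ) ^ ij.1 * ((ρ ^ (1 + l₁ * (1 + L)) : ℝ) : ℂ) ^ ij.2) :
    HasMajorant l₁ L γ d b ρ := by
  set C := ρ ^ (-((1 + L) * γ + (1 + l₁ * (1 + L)) * d)) with hC
  refine (hs.norm.mul_left (C * ‖(b γ d)⁻¹‖)).of_nonneg_of_le (fun ij => by positivity)
    fun ij => ?_
  have hle : ‖relCoeff b γ d ij‖ ≤ ‖b ij.1 ij.2‖ * ‖(b γ d)⁻¹‖ := by
    rw [relCoeff]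
    split_ifs
    · simp only [norm_zero]; positivity
    · rw [div_eq_mul_inv, norm_mul]
  have hpow : ρ ^ weight l₁ L ((ij.1 : ℤ) - γ) ((ij.2 : ℤ) - d) =
      C * ((ρ ^ (1 + L)) ^ ij.1 * (ρ ^ (1 + l₁ * (1 + L))) ^ ij.2) := by
    rw [← Real.rpow_natCast, ← Real.rpow_natCast, ← Real.rpow_mul hρ.le, ← Real.rpow_mul hρ.le,
      hC, ← Real.rpow_add hρ, ← Real.rpow_add hρ, weight]
    congr 1
    push_cast
    ring
  rw [hpow, norm_mul, norm_mul, norm_pow, norm_pow, Complex.norm_of_nonneg (by positivity),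
    Complex.norm_of_nonneg (by positivity)]
  calc _ ≤ (‖b ij.1 ij.2‖ * ‖(b γ d)⁻¹‖) *
      (C * ((ρ ^ (1 + L)) ^ ij.1 * (ρ ^ (1 + l₁ * (1 + L))) ^ ij.2)) := by gcongr
    _ = _ := by ring

theorem IsAdmissible.norm_term_le (h : IsAdmissible l₁ L δ γ d b) {ρ : ℝ} {x : ℂ × ℂ}
    (hx : x ∈ wedge l₁ L ρ) (ij : ℕ × ℕ) :
    ‖relCoeff b γ d ij * laurent ((ij.1 : ℤ) - γ) ((ij.2 : ℤ) - d) x‖ ≤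
      ‖relCoeff b γ d ij‖ * ρ ^ weight l₁ L ((ij.1 : ℤ) - γ) ((ij.2 : ℤ) - d) := by
  rw [norm_mul]
  by_cases hc : relCoeff b γ d ij = 0
  · simp [hc]
  · gcongr
    exact norm_laurent_le (h.inCone hc).1 hx

theorem IsAdmissible.hasSum_relError (h : IsAdmissible l₁ L δ γ d b) {ρ : ℝ} {x : ℂ × ℂ}
    (hρ : HasMajorant l₁ L γ d b ρ) (hx : x ∈ wedge l₁ L ρ) :
    HasSum (fun ij : ℕ × ℕ => relCoeff b γ d ij * laurent ((ij.1 : ℤ) - γ) ((ij.2 : ℤ) - d) x)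
      (relError b γ d x) :=
  (Summable.of_norm_bounded hρ (h.norm_term_le hx)).hasSum

theorem IsAdmissible.eq_mul_one_add_relError (h : IsAdmissible l₁ L δ γ d b) {ρ : ℝ} {x : ℂ × ℂ}
    {y : ℂ} (hρ : HasMajorant l₁ L γ d b ρ) (hx : x ∈ wedge l₁ L ρ)
    (hy : HasSum (fun ij : ℕ × ℕ => b ij.1 ij.2 * x.1 ^ ij.1 * x.2 ^ ij.2) y) :
    y = b γ d * x.1 ^ γ * x.2 ^ d * (1 + relError b γ d x) := by
  refine hy.unique ?_
  refine Eq.mpr (congrArg (fun F => HasSum F _) (funext fun ij => ?_))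
    (((hasSum_ite_eq (γ, d) (1 : ℂ)).add (h.hasSum_relError hρ hx)).mul_left
      (b γ d * x.1 ^ γ * x.2 ^ d))
  by_cases h0 : ij = (γ, d)
  · simp [h0, relCoeff]
  · by_cases hc : relCoeff b γ d ij = 0
    · have : b ij.1 ij.2 = 0 := by
        rw [relCoeff, if_neg h0, div_eq_zero_iff] at hc
        exact hc.resolve_right h.coeff_ne
      simp [this, hc, h0]
    · have hcone := (h.inCone hc).1
      -- This also holds on the axis z = 0: the wedge meets it only if l₁ = 0, and then the cone
      -- condition gives i ≥ γ.
      have e1 : x.1 ^ γ * x.1 ^ ((ij.1 : ℤ) - γ) = x.1 ^ ij.1 := by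
        by_cases h1 : x.1 = 0
        · have := hcone.fst_nonneg (eq_zero_of_mem_wedge_of_fst hx h1)
          obtain ⟨k, hk⟩ := Int.eq_ofNat_of_zero_le this
          rw [hk, zpow_natCast, ← pow_add]
          congr 1; omega
        · rw [← zpow_natCast, ← zpow_add₀ h1, add_sub_cancel, zpow_natCast]
      have e2 : x.2 ^ d * x.2 ^ ((ij.2 : ℤ) - d) = x.2 ^ ij.2 := by
        by_cases h1 : x.2 = 0
        · have := hcone.snd_nonneg (eq_zero_of_mem_wedge_of_snd hx h1)
          obtain ⟨k, hk⟩ := Int.eq_ofNat_of_zero_le this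
          rw [hk, zpow_natCast, ← pow_add]
          congr 1; omega
        · rw [← zpow_natCast, ← zpow_add₀ h1, add_sub_cancel, zpow_natCast]
      have e3 : b γ d * relCoeff b γ d ij = b ij.1 ij.2 := by
        rw [relCoeff, if_neg h0, mul_div_cancel₀ _ h.coeff_ne]
      rw [if_neg h0, zero_add, laurent, ← e1, ← e2, ← e3]
      ring

theorem HasMajorant.mono {ρ : ℝ} (hρ : HasMajorant l₁ L γ d b ρ)
    (h : IsAdmissible l₁ L δ γ d b) {r : ℝ}
    (hr : 0 < r) (hrρ : r ≤ ρ) : HasMajorant l₁ L γ d b r := by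
  refine Summable.of_nonneg_of_le (fun ij => by positivity) (fun ij => ?_) hρ
  by_cases hc : relCoeff b γ d ij = 0
  · simp [hc]
  · gcongr
    exact (h.inCone hc).2.le

/-- All weights of nonzero terms are positive, so each term of the majorant tends to 0 as r → 0⁺,
and dominated convergence applies to the sum. -/
theorem IsAdmissible.exists_norm_relError_le (h : IsAdmissible l₁ L δ γ d b) {ρ : ℝ}
    (hρ0 : 0 < ρ) (hρ : HasMajorant l₁ L γ d b ρ) {ε : ℝ} (hε : 0 < ε) :
    ∃ r, 0 < r ∧ r ≤ ρ ∧ ∀ x ∈ wedge l₁ L r, ‖relError b γ d x‖ ≤ ε := by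
  have hlim : Tendsto (fun r : ℝ => ∑' ij : ℕ × ℕ,
      ‖relCoeff b γ d ij‖ * r ^ weight l₁ L ((ij.1 : ℤ) - γ) ((ij.2 : ℤ) - d))
      (𝓝[>] 0) (𝓝 (∑' _ : ℕ × ℕ, 0)) := by
    refine tendsto_tsum_of_dominated_convergence hρ (fun ij => ?_) ?_
    · by_cases hc : relCoeff b γ d ij = 0
      · simp [hc]
      · have hw := (h.inCone hc).2
        have := ((Real.continuousAt_rpow_const 0 _ (Or.inr hw.le)).tendsto.mono_left
          nhdsWithin_le_nhds).const_mul ‖relCoeff b γ d ij‖ (x := 𝓝[>] 0)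
        rwa [Real.zero_rpow hw.ne', mul_zero] at this
    · filter_upwards [Ioo_mem_nhdsGT hρ0] with r hr ij
      have hr0 := hr.1
      rw [norm_mul, norm_norm, Real.norm_of_nonneg (by positivity)]
      by_cases hc : relCoeff b γ d ij = 0
      · simp [hc]
      · gcongr
        · exact (h.inCone hc).2.le
        · exact hr.2.le
  rw [tsum_zero] at hlim
  obtain ⟨r, hr, hr'⟩ := ((hlim.eventually (gt_mem_nhds hε)).and (Ioo_mem_nhdsGT hρ0)).exists
  refine ⟨r, hr'.1, hr'.2.le, fun x hx => ?_⟩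
  have hs := hρ.mono h hr'.1 hr'.2.le
  exact (tsum_of_norm_bounded hs.hasSum (h.norm_term_le hx)).trans hr.le

/-- On small wedges, `q` is the product of its dominant term and a unit. -/
theorem IsAdmissible.exists_factorization (h : IsAdmissible l₁ L δ γ d b) {q : ℂ × ℂ → ℂ}
    (hqb : HasExpansion q b) :
    ∃ ρ, 0 < ρ ∧ ρ ≤ 1 ∧ HasMajorant l₁ L γ d b ρ ∧ ∀ x ∈ wedge l₁ L ρ,
      q x = b γ d * x.1 ^ γ * x.2 ^ d * (1 + relError b γ d x) := by
  obtain ⟨R, hR, hRq⟩ := Metric.eventually_nhds_iff_ball.1 hqb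
  have hl := h.l₁_nonneg
  have hL := h.L_nonneg
  have hlim : ∀ e : ℝ, 1 ≤ e → ∀ ρ : ℝ, 0 < ρ → ρ < min R 1 → |ρ ^ e| < R := by
    intro e he ρ hρ hρ'
    rw [abs_of_nonneg (by positivity)]
    refine lt_of_le_of_lt ?_ (hρ'.trans_le (min_le_left _ _))
    simpa using Real.rpow_le_rpow_of_exponent_ge hρ (hρ'.le.trans (min_le_right _ _)) he
  have hm : 0 < min R 1 := lt_min hR one_pos
  have hmaj : HasMajorant l₁ L γ d b (min R 1 / 2) := by
    refine hasMajorant_of_summable (by positivity) (hRq (((min R 1 / 2) ^ (1 + L) : ℝ),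
      ((min R 1 / 2) ^ (1 + l₁ * (1 + L)) : ℝ)) ?_).summable
    rw [mem_ball_zero_iff, Prod.norm_def, max_lt_iff]
    simp only [Complex.norm_real, Real.norm_eq_abs]
    exact ⟨hlim _ (by linarith) _ (by positivity) (by linarith),
      hlim _ (by nlinarith) _ (by positivity) (by linarith)⟩
  have h1 : min R 1 / 2 ≤ 1 := by linarith [min_le_right R 1]
  refine ⟨min R 1 / 2, by positivity, h1, hmaj, fun x hx =>
    h.eq_mul_one_add_relError hmaj hx (hRq x ?_)⟩
  rw [mem_ball_zero_iff, Prod.norm_def, max_lt_iff]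
  constructor
  · linarith [norm_fst_lt hL h1 hx, min_le_left R 1]
  · linarith [norm_snd_lt hl hL h1 hx, min_le_left R 1]

end Expansion


/-! ### The relative error of the leading term of p, and bounds for perturbed units. -/

/-- The relative error of the leading term `a * z ^ δ` of `p`. -/
noncomputable def leadError (p : ℂ → ℂ) (a : ℂ) (δ : ℕ) (z : ℂ) : ℂ :=
  (p z - a * z ^ δ) / (a * z ^ δ)

/-- The conventional value of 0 / 0 is also the limit at 0, so the removable singularity is already
filled in correctly. -/
theorem leadError_zero {p : ℂ → ℂ} {a : ℂ} {δ : ℕ} (hδ : δ ≠ 0) : leadError p a δ 0 = 0 := by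
  simp [leadError, hδ]

theorem eq_mul_one_add_leadError {p : ℂ → ℂ} {a : ℂ} {δ : ℕ} (ha : a ≠ 0) (hδ : δ ≠ 0)
    (hp : p 0 = 0) (z : ℂ) : p z = a * z ^ δ * (1 + leadError p a δ z) := by
  by_cases hz : z = 0
  · simp [hz, hp, hδ]
  · rw [leadError, mul_add, mul_one, mul_div_cancel₀ _ (mul_ne_zero ha (pow_ne_zero _ hz))]
    ring

theorem continuousAt_leadError {p : ℂ → ℂ} {a : ℂ} {δ : ℕ} (ha : a ≠ 0) (hδ : δ ≠ 0)
    (hpa : (fun z : ℂ => p z - a * z ^ δ) =O[𝓝 0] (fun z : ℂ => z ^ (δ + 1))) :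
    ContinuousAt (leadError p a δ) 0 := by
  obtain ⟨C, hC⟩ := hpa.bound
  rw [ContinuousAt, leadError_zero hδ]
  refine squeeze_zero_norm' (a := fun z => C / ‖a‖ * ‖z‖) ?_ ?_
  · filter_upwards [hC] with z hz
    by_cases h0 : z = 0
    · simp [h0, leadError_zero hδ]
    · have h0' := norm_pos_iff.2 h0
      have ha' := norm_pos_iff.2 ha
      rw [leadError, norm_div, norm_mul, norm_pow, div_le_iff₀ (by positivity)]
      refine hz.trans_eq ?_
      rw [norm_pow, pow_succ]
      field_simp
  · have : ContinuousAt (fun z : ℂ => C / ‖a‖ * ‖z‖) 0 := by fun_prop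
    simpa [ContinuousAt] using this

theorem exists_differentiableOn_leadError {p : ℂ → ℂ} {a : ℂ} {δ : ℕ} (hp : AnalyticAt ℂ p 0)
    (ha : a ≠ 0) (hδ : δ ≠ 0)
    (hpa : (fun z : ℂ => p z - a * z ^ δ) =O[𝓝 0] (fun z : ℂ => z ^ (δ + 1))) :
    ∃ R > 0, DifferentiableOn ℂ (leadError p a δ) (Metric.ball 0 R) := by
  obtain ⟨R, hR, h⟩ := Metric.eventually_nhds_iff_ball.1 hp.eventually_analyticAt
  refine ⟨R, hR, (Complex.differentiableOn_compl_singleton_and_continuousAt_iff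
    (Metric.ball_mem_nhds 0 hR)).1 ⟨fun z hz => ?_, continuousAt_leadError ha hδ hpa⟩⟩
  have h1 := (h z hz.1).differentiableAt
  have h2 : a * z ^ δ ≠ 0 := mul_ne_zero ha (pow_ne_zero _ hz.2)
  exact ((h1.sub (by fun_prop)).div (by fun_prop) h2).differentiableWithinAt

theorem abs_log_norm_one_add_le {e : ℂ} (he : ‖e‖ ≤ 1 / 2) :
    |Real.log ‖1 + e‖| ≤ Real.log 2 := by
  have h1 : (1 / 2 : ℝ) ≤ ‖1 + e‖ := by
    have := norm_sub_norm_le (1 : ℂ) (-e)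
    rw [sub_neg_eq_add, norm_neg, norm_one] at this
    linarith
  have h2 : ‖1 + e‖ ≤ 2 := by
    have := norm_add_le (1 : ℂ) e
    rw [norm_one] at this
    linarith
  rw [abs_le, ← Real.log_inv]
  exact ⟨Real.log_le_log (by norm_num) (by simpa using h1), Real.log_le_log (by linarith) h2⟩

theorem one_add_ne_zero_of_norm_le {e : ℂ} (he : ‖e‖ ≤ 1 / 2) : 1 + e ≠ 0 := by
  intro h
  rw [eq_neg_of_add_eq_zero_right h, norm_neg, norm_one] at he
  norm_num at he

theorem norm_one_add_le_two {e : ℂ} (he : ‖e‖ ≤ 1 / 2) : ‖1 + e‖ ≤ 2 := by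
  have := norm_add_le (1 : ℂ) e
  rw [norm_one] at this
  linarith

theorem norm_mul_pow_mul_lt {c z e : ℂ} {k : ℕ} {r : ℝ} (hk : 2 ≤ k) (hr : r ≤ 1)
    (hc : 2 * (‖c‖ + 1) * r ≤ 1) (hz : ‖z‖ < r) (he : ‖e‖ ≤ 1 / 2) :
    ‖c * z ^ k * (1 + e)‖ < r := by
  have h1 : ‖z‖ ^ k ≤ r * ‖z‖ :=
    calc ‖z‖ ^ k ≤ ‖z‖ ^ 2 := pow_le_pow_of_le_one (norm_nonneg _) (hz.le.trans hr) hk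
      _ = ‖z‖ * ‖z‖ := sq _
      _ ≤ r * ‖z‖ := by gcongr
  have hr0 : 0 < r := (norm_nonneg _).trans_lt hz
  rw [norm_mul, norm_mul, norm_pow]
  calc ‖c‖ * ‖z‖ ^ k * ‖1 + e‖ ≤ ‖c‖ * (r * ‖z‖) * 2 := by
        gcongr; exact norm_one_add_le_two he
    _ = 2 * ‖c‖ * r * ‖z‖ := by ring
    _ ≤ 1 * ‖z‖ := by gcongr; nlinarith
    _ < r := by linarith

/-! ### Invariance of small wedges. -/

section Invariance

variable {b : ℕ → ℕ → ℂ} {δ γ d : ℕ} {l₁ L : ℝ} {a : ℂ}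

/-- An upper bound for the radii of the invariant wedges. -/
noncomputable def invRadius (l₁ L : ℝ) (a c : ℂ) : ℝ :=
  -- The first two bounds serve the discs and the axes, where the map is a perturbed power in one
  -- variable. The exponential makes |log r| outweigh the additive constants of the map in the
  -- coordinates τ, σ.
  min (min (1 / (2 * (‖a‖ + 1))) (1 / (2 * (‖c‖ + 1))))
    (Real.exp (-((1 + L) * (|Real.log ‖c‖| + Real.log 2) +
      (1 + l₁) * (1 + L) * (|Real.log ‖a‖| + Real.log 2))))

theorem invRadius_pos (l₁ L : ℝ) (a c : ℂ) : 0 < invRadius l₁ L a c :=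
  lt_min (lt_min (by positivity) (by positivity)) (Real.exp_pos _)

theorem invRadius_le_one (l₁ L : ℝ) (a c : ℂ) : invRadius l₁ L a c ≤ 1 := by
  refine (min_le_left _ _).trans ((min_le_left _ _).trans ?_)
  rw [div_le_one (by positivity)]
  linarith [norm_nonneg a]

theorem mul_le_one_of_le_invRadius_left {c : ℂ} {r : ℝ} (hr : r ≤ invRadius l₁ L a c) :
    2 * (‖a‖ + 1) * r ≤ 1 := by
  rw [← le_div_iff₀' (by positivity)]
  exact hr.trans ((min_le_left _ _).trans (min_le_left _ _))

theorem mul_le_one_of_le_invRadius_right {c : ℂ} {r : ℝ} (hr : r ≤ invRadius l₁ L a c) :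
    2 * (‖c‖ + 1) * r ≤ 1 := by
  rw [← le_div_iff₀' (by positivity)]
  exact hr.trans ((min_le_left _ _).trans (min_le_right _ _))

/-- The wedges are invariant under a perturbation of the monomial map. -/
theorem IsAdmissible.mem_wedge (h : IsAdmissible l₁ L δ γ d b) (ha : a ≠ 0) {r : ℝ}
    (hr : r ≤ invRadius l₁ L a (b γ d)) {x : ℂ × ℂ} (hx : x ∈ wedge l₁ L r) {e₁ e₂ : ℂ}
    (he₁ : ‖e₁‖ ≤ 1 / 2) (he₂ : ‖e₂‖ ≤ 1 / 2) (hγ : x.1 ≠ 0 ∨ γ = 0) :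
    (a * x.1 ^ δ * (1 + e₁), b γ d * x.1 ^ γ * x.2 ^ d * (1 + e₂)) ∈ wedge l₁ L r := by
  have hr0 := pos_of_mem_wedge hx
  have hr1 := hr.trans (invRadius_le_one _ _ _ _)
  have hδ0 : δ ≠ 0 := by have := h.two_le_δ; omega
  have hd0 : d ≠ 0 := by have := h.two_le_d; omega
  have n₁ := one_add_ne_zero_of_norm_le he₁
  have n₂ := one_add_ne_zero_of_norm_le he₂
  by_cases h1 : x.1 = 0
  · have hl := eq_zero_of_mem_wedge_of_fst hx h1
    have hγ0 : γ = 0 := hγ.resolve_left (fun h => h h1)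
    have hw := norm_snd_lt_of_fst hx h1
    subst hγ0
    refine ⟨?_, ?_⟩
    · simp only [h1, hl, zero_pow hδ0, mul_zero, zero_mul, zero_add, norm_zero, Real.rpow_one,
        pow_zero, mul_one]
      by_cases h2 : x.2 = 0
      · rw [eq_zero_of_mem_wedge_of_snd hx h2, Real.rpow_zero]; linarith
      · have : 0 < ‖b 0 d * x.2 ^ d * (1 + e₂)‖ :=
          norm_pos_iff.2 (mul_ne_zero (mul_ne_zero h.coeff_ne (pow_ne_zero _ h2)) n₂)
        positivity
    · simp only [hl, Real.rpow_zero, mul_one, pow_zero]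
      exact norm_mul_pow_mul_lt h.two_le_d hr1 (mul_le_one_of_le_invRadius_right hr) hw he₂
  have hz1 : a * x.1 ^ δ * (1 + e₁) ≠ 0 := mul_ne_zero (mul_ne_zero ha (pow_ne_zero _ h1)) n₁
  by_cases h2 : x.2 = 0
  · have hL := eq_zero_of_mem_wedge_of_snd hx h2
    have hz := norm_fst_lt_of_snd hx h2
    refine ⟨?_, ?_⟩
    · simp only [hL, Real.rpow_zero, mul_one, mul_zero, zero_add, Real.rpow_one]
      exact norm_mul_pow_mul_lt h.two_le_δ hr1 (mul_le_one_of_le_invRadius_left hr) hz he₁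
    · simp only [h2, zero_pow hd0, mul_zero, zero_mul, norm_zero]
      have := norm_pos_iff.2 hz1
      positivity
  have hw1 : b γ d * x.1 ^ γ * x.2 ^ d * (1 + e₂) ≠ 0 :=
    mul_ne_zero (mul_ne_zero (mul_ne_zero h.coeff_ne (pow_ne_zero _ h1)) (pow_ne_zero _ h2)) n₂
  rw [mem_wedge_iff_log hr0 hz1 hw1]
  obtain ⟨hτ, hσ⟩ := (mem_wedge_iff_log hr0 h1 h2).1 hx
  simp only [norm_mul, norm_pow]
  have p1 := (norm_pos_iff.2 h1).ne'
  have p2 := (norm_pos_iff.2 h2).ne'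
  have pa := (norm_pos_iff.2 ha).ne'
  have pb := (norm_pos_iff.2 h.coeff_ne).ne'
  have q1 := (norm_pos_iff.2 n₁).ne'
  have q2 := (norm_pos_iff.2 n₂).ne'
  rw [Real.log_mul (by positivity) q1, Real.log_mul pa (by positivity), Real.log_pow,
    Real.log_mul (by positivity) q2, Real.log_mul (by positivity) (by positivity),
    Real.log_mul pb (by positivity), Real.log_pow, Real.log_pow]
  have hlr : Real.log r ≤ -((1 + L) * (|Real.log ‖b γ d‖| + Real.log 2) +
      (1 + l₁) * (1 + L) * (|Real.log ‖a‖| + Real.log 2)) := by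
    rw [Real.log_le_iff_le_exp hr0]
    exact hr.trans (min_le_right _ _)
  have ka0 : 0 ≤ |Real.log ‖a‖| + Real.log 2 := by positivity
  have kb0 : 0 ≤ |Real.log ‖b γ d‖| + Real.log 2 := by positivity
  have bz : |Real.log ‖a‖ + Real.log ‖1 + e₁‖| ≤ |Real.log ‖a‖| + Real.log 2 :=
    (abs_add_le _ _).trans (add_le_add le_rfl (abs_log_norm_one_add_le he₁))
  have bw : |Real.log ‖b γ d‖ + Real.log ‖1 + e₂‖| ≤ |Real.log ‖b γ d‖| + Real.log 2 :=
    (abs_add_le _ _).trans (add_le_add le_rfl (abs_log_norm_one_add_le he₂))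
  set ka := |Real.log ‖a‖| + Real.log 2
  set kb := |Real.log ‖b γ d‖| + Real.log 2
  have hl := h.l₁_nonneg
  have hL := h.L_nonneg
  have hM := h.tilt_nonneg
  have h2s := h.two_le_sub
  have hK := h.excess_nonneg
  have hd' : (2 : ℝ) ≤ d := by exact_mod_cast h.two_le_d
  set M := (γ : ℝ) + l₁ * d - l₁ * δ with hMdef
  set Z := Real.log ‖x.1‖
  set W := Real.log ‖x.2‖
  set σ := W - l₁ * Z with hσdef
  set τ := Z - L * σ with hτdef
  have hZ : Z = τ + L * σ := by rw [hτdef]; ring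
  have hW : W = σ + l₁ * (τ + L * σ) := by rw [← hZ, hσdef]; ring
  set ea := Real.log ‖a‖ + Real.log ‖1 + e₁‖ with hea
  set eb := Real.log ‖b γ d‖ + Real.log ‖1 + e₂‖ with heb
  have hlr0 : Real.log r ≤ 0 := by
    have : 0 ≤ (1 + L) * kb + (1 + l₁) * (1 + L) * ka := by positivity
    linarith
  have hσ0 : σ ≤ 0 := hσ.le.trans hlr0
  have hτ0 : τ ≤ 0 := hτ.le.trans hlr0
  have bz' := abs_le.1 bz
  have bw' := abs_le.1 bw
  have t1 : l₁ * (-ea) ≤ l₁ * ka := mul_le_mul_of_nonneg_left (by linarith) hl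
  have t2 : L * (l₁ * ea - eb) ≤ L * (l₁ * ka + kb) := by
    refine mul_le_mul_of_nonneg_left ?_ hL
    linarith [mul_le_mul_of_nonneg_left bz'.2 hl]
  have hk1 : 0 ≤ L * kb := by positivity
  have hk2 : 0 ≤ L * ka := by positivity
  have hk3 : 0 ≤ l₁ * ka := by positivity
  have hk4 : 0 ≤ l₁ * L * ka := by positivity
  -- As σ, τ ≤ 0, the off-diagonal terms only help and the diagonal ones are at most 2σ and 2τ. One
  -- copy of σ or τ gives the bound log r, and the other absorbs the constants.
  have s1 : M * τ ≤ 0 := mul_nonpos_of_nonneg_of_nonpos hM hτ0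
  have s2 : L * M * σ ≤ 0 := mul_nonpos_of_nonneg_of_nonpos (by positivity) hσ0
  have s3 : d * σ ≤ 2 * σ := mul_le_mul_of_nonpos_right hd' hσ0
  have s4 : (δ - L * M) * τ ≤ 2 * τ := mul_le_mul_of_nonpos_right h2s hτ0
  have s5 : L * (δ - L * M - d) * σ ≤ 0 := mul_nonpos_of_nonneg_of_nonpos hK hσ0
  have exp1 : Real.log ‖b γ d‖ + γ * Z + d * W + Real.log ‖1 + e₂‖ -
      l₁ * (Real.log ‖a‖ + δ * Z + Real.log ‖1 + e₁‖) =
      eb + l₁ * (-ea) + M * τ + L * M * σ + d * σ := by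
    rw [hW, hZ, hMdef, hea, heb]; ring
  have exp2 : Real.log ‖a‖ + δ * Z + Real.log ‖1 + e₁‖ =
      ea + δ * (τ + L * σ) := by rw [← hZ, hea]; ring
  rw [exp1, exp2]
  constructor
  · have : ea + δ * (τ + L * σ) - L * (eb + l₁ * (-ea) + M * τ + L * M * σ + d * σ) =
      ea + L * (l₁ * ea - eb) + (δ - L * M) * τ + L * (δ - L * M - d) * σ := by ring
    rw [this]
    linarith
  · linarith

end Invariance


/-! ### Contracting affine recursions along an orbit. -/

section AffineRecursion

variable {X : Type*} {S : Set X} {T : X → X} {k : ℕ} {g F : ℕ → X → ℂ} {C : ℝ}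

/-- (C + C) / k ≤ C since k ≥ 2. -/
theorem norm_le_of_affineRecursion (hT : MapsTo T S S) (hk : 2 ≤ k) (h0 : ∀ x, F 0 x = 0)
    (hF : ∀ n x, F (n + 1) x = (F n (T x) + g n x) / k)
    (hg : ∀ n, ∀ x ∈ S, ‖g n x‖ ≤ C) (n : ℕ) : ∀ x ∈ S, ‖F n x‖ ≤ C := by
  have hk' : (2 : ℝ) ≤ k := by exact_mod_cast hk
  induction n with
  | zero =>
    intro x hx
    rw [h0, norm_zero]
    exact (norm_nonneg _).trans (hg 0 x hx)
  | succ n ih =>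
    intro x hx
    rw [hF, norm_div, Complex.norm_natCast, div_le_iff₀ (by linarith)]
    have h1 := ih _ (hT hx)
    have h2 := hg n x hx
    have h3 : C * 2 ≤ C * k := by gcongr; exact (norm_nonneg _).trans h2
    linarith [norm_add_le (F n (T x)) (g n x)]

/-- The rate 3/4 reproduces itself: half of 2C + C is 2C · 3/4. The driver `g` may depend on `n`,
because that of the second component contains the first component's approximation. -/
theorem norm_sub_le_of_affineRecursion (hT : MapsTo T S S) (hk : 2 ≤ k) (h0 : ∀ x, F 0 x = 0)
    (hF : ∀ n x, F (n + 1) x = (F n (T x) + g n x) / k)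
    (hg : ∀ n, ∀ x ∈ S, ‖g n x‖ ≤ C)
    (hg' : ∀ n, ∀ x ∈ S, ‖g (n + 1) x - g n x‖ ≤ C * (3 / 4) ^ n) (n : ℕ) :
    ∀ x ∈ S, ‖F (n + 1) x - F n x‖ ≤ 2 * C * (3 / 4) ^ n := by
  have hk' : (2 : ℝ) ≤ k := by exact_mod_cast hk
  induction n with
  | zero =>
    intro x hx
    have := norm_le_of_affineRecursion hT hk h0 hF hg 1 x hx
    rw [h0, sub_zero, pow_zero, mul_one]
    linarith [norm_nonneg (F (0 + 1) x)]
  | succ n ih =>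
    intro x hx
    rw [hF (n + 1), hF n x, ← sub_div, norm_div, Complex.norm_natCast, div_le_iff₀ (by linarith),
      add_sub_add_comm]
    have h1 := ih _ (hT hx)
    have h2 := hg' n x hx
    have hC : 0 ≤ C := (norm_nonneg _).trans (hg n x hx)
    have h3 : 2 * C * (3 / 4) ^ (n + 1) * 2 ≤ 2 * C * (3 / 4) ^ (n + 1) * k := by gcongr
    have h4 : 2 * C * (3 / 4 : ℝ) ^ (n + 1) * 2 = 2 * C * (3 / 4) ^ n + C * (3 / 4) ^ n := by
      rw [pow_succ]; ring
    linarith [norm_add_le (F (n + 1) (T x) - F n (T x)) (g (n + 1) x - g n x)]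

theorem exists_tendstoUniformlyOn_of_geometric
    (h : ∀ n, ∀ x ∈ S, ‖F (n + 1) x - F n x‖ ≤ C * (3 / 4) ^ n) :
    ∃ G, TendstoUniformlyOn F G atTop S := by
  have hd : ∀ x ∈ S, ∀ n, dist (F n x) (F (n + 1) x) ≤ C * (3 / 4) ^ n := fun x hx n => by
    rw [dist_comm, dist_eq_norm]; exact h n x hx
  have hlim : ∀ x ∈ S, ∃ y, Tendsto (fun n => F n x) atTop (𝓝 y) := fun x hx =>
    cauchySeq_tendsto_of_complete (cauchySeq_of_le_geometric _ _ (by norm_num) (hd x hx))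
  choose! G hG using hlim
  refine ⟨G, Metric.tendstoUniformlyOn_iff.2 fun ε hε => ?_⟩
  have hz : Tendsto (fun n : ℕ => C * (3 / 4 : ℝ) ^ n / (1 - 3 / 4)) atTop (𝓝 0) := by
    simpa using ((tendsto_pow_atTop_nhds_zero_of_lt_one (by norm_num)
      (by norm_num : (3 / 4 : ℝ) < 1)).const_mul C).div_const (1 - 3 / 4)
  filter_upwards [hz.eventually (gt_mem_nhds hε)] with n hn x hx
  rw [dist_comm]
  exact (dist_le_of_le_geometric_of_tendsto _ _ (by norm_num) (hd x hx) (hG x hx) n).trans_lt hn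

end AffineRecursion

/-- The map `(z, w) ↦ (z * exp (u z), w * exp (v (z, w)))`. -/
noncomputable def twist (u : ℂ → ℂ) (v : ℂ × ℂ → ℂ) (x : ℂ × ℂ) : ℂ × ℂ :=
  (x.1 * Complex.exp (u x.1), x.2 * Complex.exp (v x))

theorem twist_zero (u : ℂ → ℂ) (v : ℂ × ℂ → ℂ) : twist u v 0 = 0 := by
  simp [twist, Prod.zero_eq_mk]

/-- The two linear relations are the logarithm of f₀ ∘ φ_{n+1} = φ_n ∘ f; exponentiating them
returns the equation without extracting roots. -/
theorem monomialMap_exp {a c z w U U' V V' e₁ e₂ : ℂ} {δ γ d : ℕ} (h₁ : 1 + e₁ ≠ 0)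
    (h₂ : 1 + e₂ ≠ 0) (hU : δ * U = U' + Complex.log (1 + e₁))
    (hV : d * V = V' + (Complex.log (1 + e₂) - γ * U)) :
    monomialMap a c δ γ d (z * Complex.exp U, w * Complex.exp V) =
      (a * z ^ δ * (1 + e₁) * Complex.exp U', c * z ^ γ * w ^ d * (1 + e₂) * Complex.exp V') := by
  have k1 : Complex.exp U ^ δ = Complex.exp U' * (1 + e₁) := by
    rw [← Complex.exp_nat_mul, hU, Complex.exp_add, Complex.exp_log h₁]
  have k2 : Complex.exp U ^ γ * Complex.exp V ^ d = Complex.exp V' * (1 + e₂) := by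
    rw [← Complex.exp_nat_mul, ← Complex.exp_nat_mul, hV, ← Complex.exp_add,
      show (γ : ℂ) * U + (V' + (Complex.log (1 + e₂) - γ * U)) = V' + Complex.log (1 + e₂) by ring,
      Complex.exp_add, Complex.exp_log h₂]
  simp only [monomialMap, mul_pow, Prod.mk.injEq]
  constructor
  · rw [k1]; ring
  · calc _ = c * z ^ γ * w ^ d * (Complex.exp U ^ γ * Complex.exp V ^ d) := by ring
      _ = _ := by rw [k2]; ring

/-! ### The logarithmic recursion and its convergence. -/

section Dynamics

/-- The approximations of the first component of the logarithm of the conjugacy. -/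
noncomputable def logFst (p : ℂ → ℂ) (a : ℂ) (δ : ℕ) : ℕ → ℂ → ℂ
  | 0, _ => 0
  | n + 1, z => (logFst p a δ n (p z) + Complex.log (1 + leadError p a δ z)) / δ

/-- The approximations of the second component of the logarithm of the conjugacy. -/
noncomputable def logSnd (p : ℂ → ℂ) (q : ℂ × ℂ → ℂ) (a : ℂ) (b : ℕ → ℕ → ℂ) (δ γ d : ℕ) :
    ℕ → ℂ × ℂ → ℂ
  | 0, _ => 0
  -- The first component enters with index n + 1, because the factor z^γ of f₀ is evaluated at
  -- φ_{n+1}.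
  | n + 1, x => (logSnd p q a b δ γ d n (skew p q x) +
      (Complex.log (1 + relError b γ d x) - γ * logFst p a δ (n + 1) x.1)) / d

/-- On the disc and the wedge of radius `ρ`, the leading term of `p` and the dominant term of `q`
approximate `p` and `q` up to the relative error `ε ≤ 1 / 2`. -/
structure IsTame (l₁ L : ℝ) (p : ℂ → ℂ) (q : ℂ × ℂ → ℂ) (a : ℂ) (b : ℕ → ℕ → ℂ) (δ γ d : ℕ)
    (ε ρ : ℝ) : Prop where
  admissible : IsAdmissible l₁ L δ γ d b
  ne_zero : a ≠ 0
  p_zero : p 0 = 0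
  q_zero : q 0 = 0
  ρ_pos : 0 < ρ
  ρ_le : ρ ≤ invRadius l₁ L a (b γ d)
  majorant : HasMajorant l₁ L γ d b ρ
  q_eq : ∀ x ∈ wedge l₁ L ρ, q x = b γ d * x.1 ^ γ * x.2 ^ d * (1 + relError b γ d x)
  differentiableOn_lead : DifferentiableOn ℂ (leadError p a δ) (Metric.ball 0 ρ)
  ε_le : ε ≤ 1 / 2
  lead_le : ∀ z ∈ Metric.ball (0 : ℂ) ρ, ‖leadError p a δ z‖ ≤ ε
  rel_le : ∀ x ∈ wedge l₁ L ρ, ‖relError b γ d x‖ ≤ ε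

variable {l₁ L : ℝ} {p : ℂ → ℂ} {q : ℂ × ℂ → ℂ} {a : ℂ} {b : ℕ → ℕ → ℂ} {δ γ d : ℕ} {ε ρ : ℝ}

/-- All sufficiently small wedges are tame. -/
theorem exists_isTame (h : IsAdmissible l₁ L δ γ d b) (hp : AnalyticAt ℂ p 0) (hp0 : p 0 = 0)
    (hq0 : q 0 = 0) (ha : a ≠ 0)
    (hpa : (fun z : ℂ => p z - a * z ^ δ) =O[𝓝 0] (fun z : ℂ => z ^ (δ + 1)))
    (hqb : HasExpansion q b) {ε : ℝ} (hε : 0 < ε) (hε' : ε ≤ 1 / 2) :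
    ∃ ρ > 0, ∀ r, 0 < r → r ≤ ρ → IsTame l₁ L p q a b δ γ d ε r := by
  have hδ0 : δ ≠ 0 := by have := h.two_le_δ; omega
  obtain ⟨R, hR, hRd⟩ := exists_differentiableOn_leadError hp ha hδ0 hpa
  have hc := (continuousAt_leadError ha hδ0 hpa).tendsto.norm
  rw [leadError_zero hδ0, norm_zero] at hc
  obtain ⟨R', hR', hRε⟩ := Metric.eventually_nhds_iff_ball.1 (hc.eventually (gt_mem_nhds hε))
  obtain ⟨ρ₁, hρ₁, -, hmaj, hq⟩ := h.exists_factorization hqb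
  obtain ⟨ρ₂, hρ₂, hρ₂₁, hrel⟩ := h.exists_norm_relError_le hρ₁ hmaj hε
  refine ⟨min (min R R') (min ρ₂ (invRadius l₁ L a (b γ d))), lt_min (lt_min hR hR')
    (lt_min hρ₂ (invRadius_pos _ _ _ _)), fun r hr hrle => ?_⟩
  simp only [le_min_iff] at hrle
  obtain ⟨⟨h1, h2⟩, h3, h4⟩ := hrle
  exact
    { admissible := h
      ne_zero := ha
      p_zero := hp0
      q_zero := hq0
      ρ_pos := hr
      ρ_le := h4
      majorant := hmaj.mono h hr (h3.trans hρ₂₁)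
      q_eq := fun x hx => hq x (wedge_mono (h3.trans hρ₂₁) hx)
      differentiableOn_lead := hRd.mono (Metric.ball_subset_ball h1)
      ε_le := hε'
      lead_le := fun z hz => (hRε z (Metric.ball_subset_ball h2 hz)).le
      rel_le := fun x hx => hrel x (wedge_mono h3 hx) }

namespace IsTame

variable (h : IsTame l₁ L p q a b δ γ d ε ρ)

include h

theorem δ_ne_zero : δ ≠ 0 := by have := h.admissible.two_le_δ; omega

theorem d_ne_zero : d ≠ 0 := by have := h.admissible.two_le_d; omega

theorem ρ_le_one : ρ ≤ 1 := h.ρ_le.trans (invRadius_le_one _ _ _ _)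

theorem p_eq (z : ℂ) : p z = a * z ^ δ * (1 + leadError p a δ z) :=
  eq_mul_one_add_leadError h.ne_zero h.δ_ne_zero h.p_zero z

/-- Points of the wedge with z = 0 may be sent to the origin when γ ≥ 1. The wedge with the origin
adjoined is invariant (`mapsTo_insert`) and is the domain of the recursion. -/
theorem rel_le_insert {x : ℂ × ℂ} (hx : x ∈ insert 0 (wedge l₁ L ρ)) :
    ‖relError b γ d x‖ ≤ ε := by
  rcases hx with rfl | hx
  · rw [relError_zero, norm_zero]
    exact (norm_nonneg _).trans (h.lead_le 0 (Metric.mem_ball_self h.ρ_pos))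
  · exact h.rel_le x hx

theorem mem_ball_of_mem_insert {x : ℂ × ℂ} (hx : x ∈ insert 0 (wedge l₁ L ρ)) :
    x.1 ∈ Metric.ball (0 : ℂ) ρ := by
  rcases hx with rfl | hx
  · exact Metric.mem_ball_self h.ρ_pos
  · rw [mem_ball_zero_iff]
    exact norm_fst_lt h.admissible.L_nonneg h.ρ_le_one hx

theorem skew_eq {x : ℂ × ℂ} (hx : x ∈ insert 0 (wedge l₁ L ρ)) :
    skew p q x = (a * x.1 ^ δ * (1 + leadError p a δ x.1),
      b γ d * x.1 ^ γ * x.2 ^ d * (1 + relError b γ d x)) := by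
  refine Prod.ext (h.p_eq x.1) ?_
  rcases hx with rfl | hx
  · simp [skew, h.q_zero, h.d_ne_zero]
  · exact h.q_eq x hx

theorem one_add_lead_ne_zero {z : ℂ} (hz : z ∈ Metric.ball (0 : ℂ) ρ) :
    1 + leadError p a δ z ≠ 0 :=
  one_add_ne_zero_of_norm_le ((h.lead_le z hz).trans h.ε_le)

theorem one_add_rel_ne_zero {x : ℂ × ℂ} (hx : x ∈ insert 0 (wedge l₁ L ρ)) :
    1 + relError b γ d x ≠ 0 :=
  one_add_ne_zero_of_norm_le ((h.rel_le_insert hx).trans h.ε_le)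

theorem mapsTo_ball : MapsTo p (Metric.ball 0 ρ) (Metric.ball 0 ρ) := by
  intro z hz
  rw [h.p_eq, mem_ball_zero_iff]
  exact norm_mul_pow_mul_lt h.admissible.two_le_δ h.ρ_le_one
    (mul_le_one_of_le_invRadius_left h.ρ_le) (mem_ball_zero_iff.1 hz)
    ((h.lead_le z hz).trans h.ε_le)

theorem skew_mem {r : ℝ} (hr : r ≤ ρ) {x : ℂ × ℂ} (hx : x ∈ wedge l₁ L r) :
    skew p q x ∈ wedge l₁ L r ∨ (x.1 = 0 ∧ γ ≠ 0 ∧ skew p q x = 0) := by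
  have hx' : x ∈ insert 0 (wedge l₁ L ρ) := mem_insert_of_mem _ (wedge_mono hr hx)
  rw [h.skew_eq hx']
  by_cases hγ : x.1 ≠ 0 ∨ γ = 0
  · exact Or.inl (h.admissible.mem_wedge h.ne_zero (hr.trans h.ρ_le) hx
      ((h.lead_le _ (h.mem_ball_of_mem_insert hx')).trans h.ε_le)
      ((h.rel_le_insert hx').trans h.ε_le) hγ)
  · push Not at hγ
    refine Or.inr ⟨hγ.1, hγ.2, ?_⟩
    simp [hγ.1, hγ.2, h.δ_ne_zero]

theorem mapsTo_insert : MapsTo (skew p q) (insert 0 (wedge l₁ L ρ)) (insert 0 (wedge l₁ L ρ)) := by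
  rintro x (rfl | hx)
  · left
    simp [skew, h.p_zero, h.q_zero]
  · rcases h.skew_mem le_rfl hx with h1 | h1
    · exact mem_insert_of_mem _ h1
    · rw [h1.2.2]; exact mem_insert _ _

theorem iterate_mem {x : ℂ × ℂ} (hx : x ∈ insert 0 (wedge l₁ L ρ)) (k : ℕ) :
    (skew p q)^[k] x ∈ insert 0 (wedge l₁ L ρ) :=
  h.mapsTo_insert.iterate k hx

theorem norm_log_lead_le {z : ℂ} (hz : z ∈ Metric.ball (0 : ℂ) ρ) :
    ‖Complex.log (1 + leadError p a δ z)‖ ≤ 2 * ε := by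
  have h1 := h.lead_le z hz
  have := Complex.norm_log_one_add_half_le_self (h1.trans h.ε_le)
  linarith [norm_nonneg (leadError p a δ z)]

theorem norm_log_rel_le {x : ℂ × ℂ} (hx : x ∈ insert 0 (wedge l₁ L ρ)) :
    ‖Complex.log (1 + relError b γ d x)‖ ≤ 2 * ε := by
  have h1 := h.rel_le_insert hx
  have := Complex.norm_log_one_add_half_le_self (h1.trans h.ε_le)
  linarith [norm_nonneg (relError b γ d x)]

theorem ε_nonneg : 0 ≤ ε :=
  (norm_nonneg _).trans (h.lead_le 0 (Metric.mem_ball_self h.ρ_pos))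

theorem norm_logFst_le (n : ℕ) {z : ℂ} (hz : z ∈ Metric.ball (0 : ℂ) ρ) :
    ‖logFst p a δ n z‖ ≤ 2 * ε :=
  norm_le_of_affineRecursion (g := fun _ z => Complex.log (1 + leadError p a δ z)) h.mapsTo_ball
    h.admissible.two_le_δ (fun _ => rfl) (fun _ _ => rfl) (fun _ _ hx => h.norm_log_lead_le hx) n z
    hz

theorem norm_logFst_sub_le (n : ℕ) {z : ℂ} (hz : z ∈ Metric.ball (0 : ℂ) ρ) :
    ‖logFst p a δ (n + 1) z - logFst p a δ n z‖ ≤ 2 * (2 * ε) * (3 / 4) ^ n := by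
  have := h.ε_nonneg
  refine norm_sub_le_of_affineRecursion (g := fun _ z => Complex.log (1 + leadError p a δ z))
    h.mapsTo_ball h.admissible.two_le_δ (fun _ => rfl) (fun _ _ => rfl)
    (fun _ _ hx => h.norm_log_lead_le hx) (fun n _ _ => ?_) n z hz
  rw [sub_self, norm_zero]
  positivity

/-- The factor 1 + γ would suffice here; 1 + 2γ leaves room for the same constant to bound the
successive differences of the drivers, which carry the factor 3γ/2. -/
theorem norm_driver_le (n : ℕ) {x : ℂ × ℂ} (hx : x ∈ insert 0 (wedge l₁ L ρ)) :
    ‖Complex.log (1 + relError b γ d x) - γ * logFst p a δ (n + 1) x.1‖ ≤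
      (1 + 2 * γ) * (2 * ε) := by
  refine (norm_sub_le _ _).trans ?_
  have h1 := h.norm_log_rel_le hx
  have h2 := h.norm_logFst_le (n + 1) (h.mem_ball_of_mem_insert hx)
  have h3 : (γ : ℝ) * ‖logFst p a δ (n + 1) x.1‖ ≤ γ * (2 * ε) := by gcongr
  have h4 : 0 ≤ (γ : ℝ) * ε := mul_nonneg (Nat.cast_nonneg _) h.ε_nonneg
  rw [norm_mul, Complex.norm_natCast]
  linarith

theorem norm_logSnd_le (n : ℕ) {x : ℂ × ℂ} (hx : x ∈ insert 0 (wedge l₁ L ρ)) :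
    ‖logSnd p q a b δ γ d n x‖ ≤ (1 + 2 * γ) * (2 * ε) :=
  norm_le_of_affineRecursion (g := fun n x => Complex.log (1 + relError b γ d x) -
      γ * logFst p a δ (n + 1) x.1) h.mapsTo_insert h.admissible.two_le_d (fun _ => rfl)
    (fun _ _ => rfl) (fun n _ hx => h.norm_driver_le n hx) n x hx

theorem norm_logSnd_sub_le (n : ℕ) {x : ℂ × ℂ} (hx : x ∈ insert 0 (wedge l₁ L ρ)) :
    ‖logSnd p q a b δ γ d (n + 1) x - logSnd p q a b δ γ d n x‖ ≤
      2 * ((1 + 2 * γ) * (2 * ε)) * (3 / 4) ^ n := by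
  have hε := h.ε_nonneg
  refine norm_sub_le_of_affineRecursion (g := fun n x => Complex.log (1 + relError b γ d x) -
      γ * logFst p a δ (n + 1) x.1) h.mapsTo_insert h.admissible.two_le_d (fun _ => rfl)
    (fun _ _ => rfl) (fun n _ hx => h.norm_driver_le n hx) (fun n x hx => ?_) n x hx
  rw [sub_sub_sub_cancel_left, ← mul_sub, norm_mul, Complex.norm_natCast, norm_sub_rev]
  have h2 := h.norm_logFst_sub_le (n + 1) (h.mem_ball_of_mem_insert hx)
  calc (γ : ℝ) * ‖logFst p a δ (n + 1 + 1) x.1 - logFst p a δ (n + 1) x.1‖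
      ≤ γ * (2 * (2 * ε) * (3 / 4) ^ (n + 1)) := by gcongr
    _ = (3 / 2 * γ) * (2 * ε) * (3 / 4) ^ n := by rw [pow_succ]; ring
    _ ≤ (1 + 2 * γ) * (2 * ε) * (3 / 4) ^ n := by
        gcongr
        have : (0 : ℝ) ≤ γ := Nat.cast_nonneg _
        linarith

end IsTame

end Dynamics


/-! ### Holomorphy of the approximations, functional equations and limits. -/

section Dynamics

variable {l₁ L : ℝ} {p : ℂ → ℂ} {q : ℂ × ℂ → ℂ} {a : ℂ} {b : ℕ → ℕ → ℂ} {δ γ d : ℕ} {ε ρ : ℝ}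

/-- In the cone coordinates A + l₁B and L(A + l₁B) + B, pulling back by f₀ acts by the transpose of
the nonnegative matrix that acts on (τ, σ). -/
theorem InCone.pullback (h : IsAdmissible l₁ L δ γ d b) {A B : ℤ} (hc : InCone l₁ L A B) :
    InCone l₁ L (δ * A + γ * B) (d * B) := by
  have h1 := mul_nonneg (zero_le_two.trans h.two_le_sub) hc.1
  have h2 := mul_nonneg h.tilt_nonneg hc.2
  have h3 := mul_nonneg h.excess_nonneg hc.1
  have h4 := mul_nonneg (add_nonneg (mul_nonneg h.L_nonneg h.tilt_nonneg)
    (Nat.cast_nonneg d)) hc.2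
  constructor <;> push_cast <;> linarith

theorem laurent_zero {A B : ℤ} (h : ¬ (A = 0 ∧ B = 0)) : laurent A B 0 = 0 := by
  rw [not_and_or] at h
  rcases h with h | h <;> simp [laurent, zero_zpow _ h]

/-- The pull-back of a Laurent monomial by a perturbed monomial map. -/
theorem laurent_monomial (h : IsAdmissible l₁ L δ γ d b) {r : ℝ} {x : ℂ × ℂ}
    (hx : x ∈ insert 0 (wedge l₁ L r)) {A B : ℤ} (hc : InCone l₁ L A B) (c e₁ e₂ : ℂ) :
    laurent A B (a * x.1 ^ δ * e₁, c * x.1 ^ γ * x.2 ^ d * e₂) =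
      a ^ A * c ^ B * (e₁ ^ A * e₂ ^ B) * laurent (δ * A + γ * B) (d * B) x := by
  have hδ0 : δ ≠ 0 := by have := h.two_le_δ; omega
  have hd0 : d ≠ 0 := by have := h.two_le_d; omega
  by_cases hAB : A = 0 ∧ B = 0
  · simp [hAB.1, hAB.2, laurent]
  -- For base 0 the exponent can be split only if the sum is nonzero or both summands vanish. Here
  -- l₁ = 0, and the cone condition gives A ≥ 0, and δA + γB > 0 if A > 0.
  have hz : x ≠ 0 → x.1 = 0 → x.1 ^ (δ * A + γ * B) = x.1 ^ (δ * A : ℤ) * x.1 ^ (γ * B : ℤ) := by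
    intro hx0 hx1
    have hxw := mem_of_mem_insert_of_ne hx hx0
    have hl := eq_zero_of_mem_wedge_of_fst hxw hx1
    refine zpow_add' ?_
    have hA := hc.fst_nonneg hl
    rcases hA.eq_or_lt with rfl | hA
    · by_cases hB : (γ : ℤ) * B = 0
      · right; right; exact ⟨by simp, hB⟩
      · right; left; simpa using hB
    · right; left
      have e1 := h.two_le_sub
      have e2 := mul_nonneg h.tilt_nonneg hc.2
      have e3 : (0 : ℝ) < (δ * A + γ * B : ℤ) := by
        push_cast
        have hA' : (0 : ℝ) < A := by exact_mod_cast hA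
        have := mul_le_mul_of_nonneg_right e1 hA'.le
        rw [hl] at e2 this
        linarith
      exact (by exact_mod_cast e3 : (0 : ℤ) < δ * A + γ * B).ne'
  by_cases hx0 : x = 0
  · subst hx0
    have h1 : ¬ ((δ * A + γ * B : ℤ) = 0 ∧ (d * B : ℤ) = 0) := by
      rintro ⟨h1, h2⟩
      have hB : B = 0 := by
        rcases mul_eq_zero.1 h2 with h2 | h2
        · exact absurd (by exact_mod_cast h2) hd0
        · exact h2
      rw [hB, mul_zero, add_zero] at h1
      rcases mul_eq_zero.1 h1 with h1 | h1
      · exact absurd (by exact_mod_cast h1) hδ0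
      · exact hAB ⟨h1, hB⟩
    rw [laurent_zero h1]
    have := laurent_zero hAB
    simpa [hδ0, hd0, Prod.zero_eq_mk] using this
  · have hadd : x.1 ^ (δ * A + γ * B : ℤ) = x.1 ^ (δ * A : ℤ) * x.1 ^ (γ * B : ℤ) := by
      by_cases hx1 : x.1 = 0
      · exact hz hx0 hx1
      · exact zpow_add₀ hx1 _ _
    simp only [laurent, mul_zpow, hadd, zpow_mul, zpow_natCast]
    ring

theorem skew_iterate_fst (k : ℕ) (x : ℂ × ℂ) : ((skew p q)^[k] x).1 = p^[k] x.1 := by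
  induction k generalizing x with
  | zero => rfl
  | succ k ih => rw [Function.iterate_succ_apply, ih, Function.iterate_succ_apply]; rfl

namespace IsTame

variable (h : IsTame l₁ L p q a b δ γ d ε ρ)

include h

theorem norm_term_le_insert {x : ℂ × ℂ} (hx : x ∈ insert 0 (wedge l₁ L ρ)) (ij : ℕ × ℕ) :
    ‖relCoeff b γ d ij * laurent ((ij.1 : ℤ) - γ) ((ij.2 : ℤ) - d) x‖ ≤
      ‖relCoeff b γ d ij‖ * ρ ^ weight l₁ L ((ij.1 : ℤ) - γ) ((ij.2 : ℤ) - d) := by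
  have := h.ρ_pos
  rcases hx with rfl | hx
  · by_cases hc : relCoeff b γ d ij = 0
    · simp [hc]
    · rw [laurent_zero, mul_zero, norm_zero]
      · positivity
      · rintro ⟨h1, h2⟩
        have := (h.admissible.inCone hc).2
        rw [h1, h2] at this
        simp [weight] at this
  · exact h.admissible.norm_term_le hx ij

theorem differentiableOn_p : DifferentiableOn ℂ p (Metric.ball 0 ρ) := by
  have : DifferentiableOn ℂ (fun z => a * z ^ δ * (1 + leadError p a δ z)) (Metric.ball 0 ρ) :=
    (by fun_prop : Differentiable ℂ fun z : ℂ => a * z ^ δ).differentiableOn.mul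
      (h.differentiableOn_lead.const_add 1)
  exact this.congr fun z _ => h.p_eq z

theorem differentiableOn_iterate_p (k : ℕ) : DifferentiableOn ℂ (p^[k]) (Metric.ball 0 ρ) :=
  DifferentiableOn.iterate h.differentiableOn_p h.mapsTo_ball k

theorem differentiableOn_logFst (n : ℕ) :
    DifferentiableOn ℂ (logFst p a δ n) (Metric.ball 0 ρ) := by
  induction n with
  | zero => exact differentiableOn_const 0
  | succ n ih =>
    refine DifferentiableOn.div_const (DifferentiableOn.add
      (ih.comp h.differentiableOn_p h.mapsTo_ball)
      ((h.differentiableOn_lead.const_add 1).clog fun z hz => ?_)) _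
    exact Complex.mem_slitPlane_of_norm_lt_one (by linarith [h.lead_le z hz, h.ε_le])

theorem differentiableOn_fst_iterate {g : ℂ → ℂ} (hg : DifferentiableOn ℂ g (Metric.ball 0 ρ))
    (k : ℕ) : DifferentiableOn ℂ (fun x => g ((skew p q)^[k] x).1) (wedge l₁ L ρ) := by
  have hm : MapsTo Prod.fst (wedge l₁ L ρ) (Metric.ball (0 : ℂ) ρ) := fun x hx =>
    h.mem_ball_of_mem_insert (mem_insert_of_mem _ hx)
  have := (hg.comp (h.differentiableOn_iterate_p k) (h.mapsTo_ball.iterate k)).comp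
    differentiableOn_fst hm
  exact this.congr fun x _ => by simp [skew_iterate_fst]

/-- An iterate can reach the origin, possibly outside the wedge, so the chain rule is not available.
Instead the series composed with the iterate converges uniformly, and its terms are holomorphic by
assumption. -/
theorem differentiableOn_relError_iterate {k : ℕ}
    (hl : ∀ A B, InCone l₁ L A B →
      DifferentiableOn ℂ (fun x => laurent A B ((skew p q)^[k] x)) (wedge l₁ L ρ)) :
    DifferentiableOn ℂ (fun x => relError b γ d ((skew p q)^[k] x)) (wedge l₁ L ρ) := by
  have hu : TendstoUniformlyOn (fun (t : Finset (ℕ × ℕ)) x => ∑ ij ∈ t,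
      relCoeff b γ d ij * laurent ((ij.1 : ℤ) - γ) ((ij.2 : ℤ) - d) ((skew p q)^[k] x))
      (fun x => relError b γ d ((skew p q)^[k] x)) atTop (wedge l₁ L ρ) :=
    tendstoUniformlyOn_tsum h.majorant fun ij x hx =>
      h.norm_term_le_insert (h.iterate_mem (mem_insert_of_mem _ hx) k) ij
  refine differentiableOn_of_tendstoUniformlyOn
    (isOpen_wedge h.admissible.l₁_nonneg h.admissible.L_nonneg) (fun t => ?_) hu
  refine DifferentiableOn.fun_sum fun ij _ => ?_
  by_cases hc : relCoeff b γ d ij = 0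
  · simp only [hc, zero_mul]
    exact differentiableOn_const 0
  · exact (hl _ _ (h.admissible.inCone hc).1).const_mul _

/-- One application of f turns a monomial of the cone into another one times integer powers of the
units 1 + η and 1 + ζ. The iterates are thus peeled off one by one without differentiating at the
origin. -/
theorem differentiableOn_laurent_iterate (k : ℕ) :
    ∀ A B, InCone l₁ L A B →
      DifferentiableOn ℂ (fun x => laurent A B ((skew p q)^[k] x)) (wedge l₁ L ρ) := by
  induction k with
  | zero => exact fun A B hc x hx => (differentiableAt_laurent hc hx).differentiableWithinAt
  | succ k ih =>
    intro A B hc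
    have h1 := (h.differentiableOn_fst_iterate h.differentiableOn_lead k).const_add 1
    have h2 := (h.differentiableOn_relError_iterate ih).const_add 1
    have h3 := ih _ _ (hc.pullback h.admissible)
    have hmem := fun x (hx : x ∈ wedge l₁ L ρ) => h.iterate_mem (mem_insert_of_mem _ hx) k
    have h4 : DifferentiableOn ℂ (fun x => a ^ A * b γ d ^ B *
        ((1 + leadError p a δ ((skew p q)^[k] x).1) ^ A *
          (1 + relError b γ d ((skew p q)^[k] x)) ^ B) *
        laurent (δ * A + γ * B) (d * B) ((skew p q)^[k] x)) (wedge l₁ L ρ) := by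
      refine DifferentiableOn.mul (DifferentiableOn.const_mul (DifferentiableOn.mul
        (h1.zpow (Or.inl fun x hx => ?_)) (h2.zpow (Or.inl fun x hx => ?_))) _) h3
      · exact h.one_add_lead_ne_zero (h.mem_ball_of_mem_insert (hmem x hx))
      · exact h.one_add_rel_ne_zero (hmem x hx)
    refine h4.congr fun x hx => ?_
    rw [Function.iterate_succ_apply', h.skew_eq (hmem x hx),
      laurent_monomial h.admissible (hmem x hx) hc]

/-- All iterates are treated at once, since stage n + 1 at f^k involves stage n at f^(k+1). -/
theorem differentiableOn_logSnd_iterate (n : ℕ) : ∀ k,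
    DifferentiableOn ℂ (fun x => logSnd p q a b δ γ d n ((skew p q)^[k] x)) (wedge l₁ L ρ) := by
  induction n with
  | zero => exact fun k => differentiableOn_const 0
  | succ n ih =>
    intro k
    have h1 := ih (k + 1)
    simp only [Function.iterate_succ_apply'] at h1
    have h2 := ((h.differentiableOn_relError_iterate
      (h.differentiableOn_laurent_iterate k)).const_add 1).clog fun x hx =>
        Complex.mem_slitPlane_of_norm_lt_one (by
          linarith [h.rel_le_insert (h.iterate_mem (mem_insert_of_mem _ hx) k), h.ε_le])
    have h3 := (h.differentiableOn_fst_iterate (h.differentiableOn_logFst (n + 1)) k).const_mul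
      (γ : ℂ)
    exact ((h1.fun_add (h2.fun_sub h3)).mul_const (d : ℂ)⁻¹).congr fun x _ => div_eq_mul_inv _ _

theorem differentiableOn_logSnd (n : ℕ) :
    DifferentiableOn ℂ (logSnd p q a b δ γ d n) (wedge l₁ L ρ) :=
  h.differentiableOn_logSnd_iterate n 0

theorem monomialMap_twist_succ (n : ℕ) {x : ℂ × ℂ} (hx : x ∈ insert 0 (wedge l₁ L ρ)) :
    monomialMap a (b γ d) δ γ d (twist (logFst p a δ (n + 1)) (logSnd p q a b δ γ d (n + 1)) x) =
      twist (logFst p a δ n) (logSnd p q a b δ γ d n) (skew p q x) := by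
  have hδ : (δ : ℂ) ≠ 0 := Nat.cast_ne_zero.2 h.δ_ne_zero
  have hd : (d : ℂ) ≠ 0 := Nat.cast_ne_zero.2 h.d_ne_zero
  have hU : (δ : ℂ) * logFst p a δ (n + 1) x.1 = logFst p a δ n (p x.1) +
      Complex.log (1 + leadError p a δ x.1) := mul_div_cancel₀ _ hδ
  have hV : (d : ℂ) * logSnd p q a b δ γ d (n + 1) x = logSnd p q a b δ γ d n (skew p q x) +
      (Complex.log (1 + relError b γ d x) - γ * logFst p a δ (n + 1) x.1) := mul_div_cancel₀ _ hd
  rw [twist, monomialMap_exp (h.one_add_lead_ne_zero (h.mem_ball_of_mem_insert hx))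
    (h.one_add_rel_ne_zero hx) hU hV, twist, h.skew_eq hx]
  simp only [← h.p_eq]

theorem iterate_monomialMap_twist (n : ℕ) : ∀ {x : ℂ × ℂ}, x ∈ insert 0 (wedge l₁ L ρ) →
    (monomialMap a (b γ d) δ γ d)^[n]
      (twist (logFst p a δ n) (logSnd p q a b δ γ d n) x) = (skew p q)^[n] x := by
  induction n with
  | zero => intro x _; simp [twist, logFst, logSnd]
  | succ n ih =>
    intro x hx
    rw [Function.iterate_succ_apply, h.monomialMap_twist_succ n hx, ih (h.mapsTo_insert hx),
      Function.iterate_succ_apply]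

theorem differentiableOn_twist {u : ℂ → ℂ} {v : ℂ × ℂ → ℂ}
    (hu : DifferentiableOn ℂ u (Metric.ball 0 ρ)) (hv : DifferentiableOn ℂ v (wedge l₁ L ρ)) :
    DifferentiableOn ℂ (twist u v) (wedge l₁ L ρ) := by
  have hu' := h.differentiableOn_fst_iterate hu 0
  exact (differentiableOn_fst.mul hu'.cexp).prodMk (differentiableOn_snd.mul hv.cexp)

/-- The logarithms of the approximate conjugacies converge uniformly. -/
theorem exists_limit : ∃ (u : ℂ → ℂ) (v : ℂ × ℂ → ℂ),
    TendstoUniformlyOn (logFst p a δ) u atTop (Metric.ball 0 ρ) ∧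
    TendstoUniformlyOn (logSnd p q a b δ γ d) v atTop (insert 0 (wedge l₁ L ρ)) := by
  obtain ⟨u, hu⟩ := exists_tendstoUniformlyOn_of_geometric
    (F := logFst p a δ) fun n _ hz => h.norm_logFst_sub_le n hz
  obtain ⟨v, hv⟩ := exists_tendstoUniformlyOn_of_geometric
    (F := logSnd p q a b δ γ d) fun n _ hx => h.norm_logSnd_sub_le n hx
  exact ⟨u, v, hu, hv⟩

section Limit

variable {u : ℂ → ℂ} {v : ℂ × ℂ → ℂ}
  (hu : TendstoUniformlyOn (logFst p a δ) u atTop (Metric.ball 0 ρ))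
  (hv : TendstoUniformlyOn (logSnd p q a b δ γ d) v atTop (insert 0 (wedge l₁ L ρ)))

include hu hv

theorem monomialMap_twist_limit {x : ℂ × ℂ} (hx : x ∈ insert 0 (wedge l₁ L ρ)) :
    twist u v (skew p q x) = monomialMap a (b γ d) δ γ d (twist u v x) := by
  have hlim : ∀ y ∈ insert 0 (wedge l₁ L ρ), Tendsto (fun n =>
      twist (logFst p a δ n) (logSnd p q a b δ γ d n) y) atTop (𝓝 (twist u v y)) := by
    intro y hy
    have h1 := hu.tendsto_at (h.mem_ball_of_mem_insert hy)
    have h2 := hv.tendsto_at hy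
    exact (h1.cexp.const_mul _).prodMk_nhds (h2.cexp.const_mul _)
  have hc : Continuous (monomialMap a (b γ d) δ γ d) := by unfold monomialMap; fun_prop
  refine tendsto_nhds_unique (hlim _ (h.mapsTo_insert hx)) ?_
  have := (hc.tendsto _).comp ((hlim x hx).comp (tendsto_add_atTop_nat 1))
  exact this.congr fun n => h.monomialMap_twist_succ n hx

end Limit

end IsTame

end Dynamics


/-! ### Injectivity and biholomorphy of small twists. -/

section Biholomorphic

theorem norm_exp_sub_one_le_two_mul {z : ℂ} (hz : ‖z‖ ≤ 1) : ‖Complex.exp z - 1‖ ≤ 2 * ‖z‖ :=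
  Complex.norm_exp_sub_one_le hz

/-- `w ↦ w * exp (g w)` is injective if `g` is holomorphic and small on discs about the points of
`S`, of radii proportional to their distances from the origin. -/
theorem injOn_mul_exp {S : Set ℂ} {g : ℂ → ℂ}
    (hd : ∀ w ∈ S, w ≠ 0 → DifferentiableOn ℂ g (Metric.ball w (‖w‖ / 2)))
    (hg : ∀ w ∈ S, w ≠ 0 → ∀ y ∈ Metric.ball w (‖w‖ / 2), ‖g y‖ ≤ 1 / 20) :
    InjOn (fun w => w * Complex.exp (g w)) S := by
  intro w hw w' hw' heq
  simp only at heq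
  by_cases h0 : w = 0
  · rw [h0, zero_mul, eq_comm, mul_eq_zero] at heq
    rw [h0, heq.resolve_right (Complex.exp_ne_zero _)]
  have h0' : w' ≠ 0 := by
    rintro rfl
    rw [zero_mul, mul_eq_zero] at heq
    exact h0 (heq.resolve_right (Complex.exp_ne_zero _))
  have hn := norm_pos_iff.2 h0
  have g1 := hg w hw h0 w (Metric.mem_ball_self (half_pos hn))
  have g2 := hg w' hw' h0' w' (Metric.mem_ball_self (half_pos (norm_pos_iff.2 h0')))
  -- This identity is used twice: the crude bound on `g` puts w' into the disc about w, and then the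
  -- Lipschitz bound from Cauchy's estimate gives ‖w' - w‖ ≤ (2/5)‖w' - w‖.
  have h1 : w' - w = w * (Complex.exp (g w - g w') - 1) := by
    rw [Complex.exp_sub, mul_sub, mul_div_assoc', heq, mul_div_assoc,
      div_self (Complex.exp_ne_zero _)]
    ring
  have h2 : ‖g w - g w'‖ ≤ 1 / 10 := by linarith [norm_sub_le (g w) (g w')]
  have h3 : ‖w' - w‖ ≤ ‖w‖ * (2 * ‖g w - g w'‖) := by
    rw [h1, norm_mul]
    gcongr
    exact norm_exp_sub_one_le_two_mul (by linarith)
  have hmem : w' ∈ Metric.ball w (‖w‖ / 2) := by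
    rw [Metric.mem_ball, dist_eq_norm]
    nlinarith
  have h4 := dist_le_of_norm_le (hd w hw h0) (hg w hw h0) hmem
  rw [dist_comm, dist_eq_norm, dist_eq_norm] at h4
  have h5 : ‖w‖ * (2 * ‖g w - g w'‖) ≤ 2 / 5 * ‖w' - w‖ := by
    calc ‖w‖ * (2 * ‖g w - g w'‖) ≤ ‖w‖ * (2 * (2 * (1 / 20) / (‖w‖ / 2) * ‖w' - w‖)) := by
          gcongr
      _ = 2 / 5 * ‖w' - w‖ := by field_simp; ring
  have h6 : ‖w' - w‖ = 0 := le_antisymm (by linarith [norm_nonneg (w' - w)]) (norm_nonneg _)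
  exact (sub_eq_zero.1 (norm_eq_zero.1 h6)).symm

/-- The derivative is exp(g)(1 + w g'), and Cauchy's estimate gives |w g'| ≤ 1/5. -/
theorem exists_hasDerivAt_mul_exp {g : ℂ → ℂ} {w : ℂ} (hdw : DifferentiableAt ℂ g w)
    (hd : w ≠ 0 → DifferentiableOn ℂ g (Metric.ball w (‖w‖ / 2)))
    (hg : w ≠ 0 → ∀ y ∈ Metric.ball w (‖w‖ / 2), ‖g y‖ ≤ 1 / 20) :
    ∃ D ≠ 0, HasDerivAt (fun w => w * Complex.exp (g w)) D w := by
  refine ⟨_, ?_, (hasDerivAt_id w).mul hdw.hasDerivAt.cexp⟩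
  have : 1 * Complex.exp (g w) + id w * (Complex.exp (g w) * deriv g w) =
      Complex.exp (g w) * (1 + w * deriv g w) := by simp only [id]; ring
  rw [this]
  refine mul_ne_zero (Complex.exp_ne_zero _) ?_
  by_cases h0 : w = 0
  · simp [h0]
  have hn := norm_pos_iff.2 h0
  have h1 := norm_fderiv_le_of_norm_le (half_pos hn) (hd h0) (hg h0)
  rw [← norm_deriv_eq_norm_fderiv] at h1
  refine one_add_ne_zero_of_norm_le ?_
  rw [norm_mul]
  calc ‖w‖ * ‖deriv g w‖ ≤ ‖w‖ * (2 * (1 / 20) / (‖w‖ / 2)) := by gcongr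
    _ ≤ 1 / 2 := by field_simp; norm_num

variable {l₁ L : ℝ}

/-- On this disc |w| changes by a factor between 1/2 and 2, which enlarges the radius of the wedge
by at most 2^(L+1). -/
theorem slice_ball_subset_wedge (hL : 0 ≤ L) {r : ℝ} {x : ℂ × ℂ} (hx : x ∈ wedge l₁ L r) {w : ℂ}
    (hw : w ∈ Metric.ball x.2 (‖x.2‖ / 2)) : (x.1, w) ∈ wedge l₁ L (2 ^ (L + 1) * r) := by
  have hr := pos_of_mem_wedge hx
  rw [Metric.mem_ball, dist_eq_norm] at hw
  have h1 : ‖x.2‖ ≤ 2 * ‖w‖ := by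
    have := norm_sub_norm_le x.2 w
    rw [norm_sub_rev] at this
    linarith
  have h2 : ‖w‖ ≤ 2 * ‖x.2‖ := by linarith [norm_sub_norm_le w x.2, norm_nonneg x.2]
  have h3 : (2 : ℝ) ^ (L + 1) = 2 ^ L * 2 := by rw [Real.rpow_add two_pos, Real.rpow_one]
  have h4 : (1 : ℝ) ≤ 2 ^ L := Real.one_le_rpow one_le_two hL
  constructor
  · calc ‖x.1‖ ^ (l₁ * L + 1) < r * ‖x.2‖ ^ L := hx.1
      _ ≤ r * (2 * ‖w‖) ^ L := by gcongr
      _ = 2 ^ L * 1 * r * ‖w‖ ^ L := by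
          rw [Real.mul_rpow zero_le_two (norm_nonneg _)]; ring
      _ ≤ 2 ^ L * 2 * r * ‖w‖ ^ L := by gcongr; norm_num
      _ = 2 ^ (L + 1) * r * ‖w‖ ^ L := by rw [h3]
  · calc ‖w‖ ≤ 2 * ‖x.2‖ := h2
      _ < 2 * (r * ‖x.1‖ ^ l₁) := by gcongr; exact hx.2
      _ = 1 * 2 * r * ‖x.1‖ ^ l₁ := by ring
      _ ≤ 2 ^ L * 2 * r * ‖x.1‖ ^ l₁ := by gcongr
      _ = 2 ^ (L + 1) * r * ‖x.1‖ ^ l₁ := by rw [h3]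

/-- The first component depends on z alone, so injectivity and the kernel of the derivative are
settled first in z and then in w on the slice with z fixed. -/
theorem isBiholomorphicOn_twist (hl : 0 ≤ l₁) (hL : 0 ≤ L) {ρ r : ℝ} (hρ1 : ρ ≤ 1)
    (hr : 2 ^ (L + 1) * r ≤ ρ) {u : ℂ → ℂ} {v : ℂ × ℂ → ℂ}
    (hu : DifferentiableOn ℂ u (Metric.ball 0 ρ)) (hv : DifferentiableOn ℂ v (wedge l₁ L ρ))
    (hd : DifferentiableOn ℂ (twist u v) (wedge l₁ L ρ))
    (hu' : ∀ z ∈ Metric.ball (0 : ℂ) ρ, ‖u z‖ ≤ 1 / 20)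
    (hv' : ∀ x ∈ wedge l₁ L ρ, ‖v x‖ ≤ 1 / 20) :
    IsBiholomorphicOn (twist u v) (wedge l₁ L r) := by
  have hrρ : ∀ x ∈ wedge l₁ L r, 2 * r ≤ ρ := fun x hx => by
    have hr0 := pos_of_mem_wedge hx
    refine le_trans ?_ hr
    gcongr
    simpa using Real.rpow_le_rpow_of_exponent_le one_le_two (show 1 ≤ L + 1 by linarith)
  have hsub : wedge l₁ L r ⊆ wedge l₁ L ρ := fun x hx => by
    have := hrρ x hx
    exact wedge_mono (by linarith [pos_of_mem_wedge hx]) hx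
  have hopen : IsOpen (wedge l₁ L r) := isOpen_wedge hl hL
  have hbz : ∀ x ∈ wedge l₁ L r, Metric.ball x.1 (‖x.1‖ / 2) ⊆ Metric.ball 0 ρ := by
    intro x hx
    have h1 := hrρ x hx
    have h2 := norm_fst_lt hL (by linarith [pos_of_mem_wedge hx]) hx
    refine Metric.ball_subset_ball' ?_
    rw [dist_zero_right]
    linarith [pos_of_mem_wedge hx]
  have hbw : ∀ x ∈ wedge l₁ L r,
      MapsTo (fun w => (x.1, w)) (Metric.ball x.2 (‖x.2‖ / 2)) (wedge l₁ L ρ) := fun x hx w hw =>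
    wedge_mono hr (slice_ball_subset_wedge hL hx hw)
  have hslice : ∀ z : ℂ, Differentiable ℂ fun w : ℂ => (z, w) := fun z => by fun_prop
  have hinj : InjOn (twist u v) (wedge l₁ L r) := by
    intro x hx y hy hxy
    have h1 : x.1 * Complex.exp (u x.1) = y.1 * Complex.exp (u y.1) := congrArg Prod.fst hxy
    have h2 : x.2 * Complex.exp (v x) = y.2 * Complex.exp (v y) := congrArg Prod.snd hxy
    have e1 : x.1 = y.1 := by
      refine injOn_mul_exp (S := Prod.fst '' wedge l₁ L r) (g := u) ?_ ?_ ⟨x, hx, rfl⟩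
        ⟨y, hy, rfl⟩ h1
      · rintro _ ⟨x, hx, rfl⟩ -
        exact hu.mono (hbz x hx)
      · rintro _ ⟨x, hx, rfl⟩ - y hy
        exact hu' y (hbz x hx hy)
    have e2 : x.2 = y.2 := by
      refine injOn_mul_exp (S := {w | (x.1, w) ∈ wedge l₁ L r}) (g := fun w => v (x.1, w))
        ?_ ?_ hx (by rw [e1]; exact hy) (by simp only [Prod.mk.eta]; rw [h2, e1])
      · intro w hw _
        exact hv.comp (hslice _).differentiableOn (hbw _ hw)
      · intro w hw _ y hy
        exact hv' _ (hbw _ hw hy)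
    exact Prod.ext e1 e2
  have hker : ∀ x ∈ wedge l₁ L r, ∀ t, fderiv ℂ (twist u v) x t = 0 → t = 0 := by
    intro x hx t ht
    have hfd := (hd.differentiableAt ((isOpen_wedge hl hL).mem_nhds (hsub hx))).hasFDerivAt
    have h1ρ := hrρ x hx
    have hx1 : x.1 ∈ Metric.ball (0 : ℂ) ρ := by
      rw [mem_ball_zero_iff]
      have := pos_of_mem_wedge hx
      linarith [norm_fst_lt hL (by linarith) hx]
    obtain ⟨D, hD, hDu⟩ := exists_hasDerivAt_mul_exp (g := u)
      (hu.differentiableAt (Metric.isOpen_ball.mem_nhds hx1)) (fun _ => hu.mono (hbz x hx))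
      (fun _ y hy => hu' y (hbz x hx hy))
    obtain ⟨D', hD', hDv⟩ := exists_hasDerivAt_mul_exp (g := fun w => v (x.1, w)) (w := x.2)
      (DifferentiableAt.comp x.2
        (hv.differentiableAt ((isOpen_wedge hl hL).mem_nhds (hsub hx))) (hslice x.1 x.2))
      (fun _ => hv.comp (hslice _).differentiableOn (hbw x hx))
      (fun _ y hy => hv' _ (hbw x hx hy))
    have h1 : (ContinuousLinearMap.fst ℂ ℂ ℂ).comp (fderiv ℂ (twist u v) x) =
        D • ContinuousLinearMap.fst ℂ ℂ ℂ :=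
      (hasFDerivAt_fst.comp x hfd).unique (hDu.comp_hasFDerivAt x hasFDerivAt_fst)
    have h2 : (fderiv ℂ (twist u v) x (0, 1)).2 = D' := by
      have hs : HasDerivAt (fun w : ℂ => (x.1, w)) ((0 : ℂ), (1 : ℂ)) x.2 :=
        (hasDerivAt_const _ _).prodMk (hasDerivAt_id _)
      have := (hasFDerivAt_snd (𝕜 := ℂ)).comp_hasDerivAt x.2
        (HasFDerivAt.comp_hasDerivAt (l := twist u v) x.2 hfd hs)
      exact this.unique hDv
    have ht1 : t.1 = 0 := by
      have := congrArg (fun A => A t) h1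
      simp only [ContinuousLinearMap.comp_apply, ht, map_zero, smul_apply,
        ContinuousLinearMap.coe_fst', smul_eq_mul] at this
      exact (mul_eq_zero.1 this.symm).resolve_left hD
    have ht2 : t = t.2 • ((0 : ℂ), (1 : ℂ)) := Prod.ext (by simp [ht1]) (by simp)
    rw [ht2, map_smul] at ht
    have := congrArg Prod.snd ht
    rw [Prod.smul_snd, h2, smul_eq_mul] at this
    rw [ht2, (mul_eq_zero.1 this).resolve_right hD', zero_smul]
  obtain ⟨h1, h2⟩ := exists_holomorphic_inverse hopen (hd.mono hsub) hinj hker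
  exact ⟨hopen, h1, hd.mono hsub, h2⟩

end Biholomorphic

/-! ### Estimates for exponentials and convergence of twists. -/

section Estimates

theorem norm_mul_exp_sub_le {z U : ℂ} {κ : ℝ} (hκ : κ ≤ 1) (hU : ‖U‖ ≤ κ) :
    ‖z * Complex.exp U - z‖ ≤ 2 * κ * ‖z‖ := by
  have : z * Complex.exp U - z = (Complex.exp U - 1) * z := by ring
  rw [this, norm_mul]
  gcongr
  linarith [norm_exp_sub_one_le_two_mul (hU.trans hκ)]

theorem norm_exp_sub_exp_le {U V : ℂ} (hU : ‖U‖ ≤ 1 / 2) (hV : ‖V‖ ≤ 1 / 2) :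
    ‖Complex.exp U - Complex.exp V‖ ≤ 4 * ‖U - V‖ := by
  have : Complex.exp U - Complex.exp V = Complex.exp V * (Complex.exp (U - V) - 1) := by
    rw [Complex.exp_sub, mul_sub, mul_div_cancel₀ _ (Complex.exp_ne_zero _), mul_one]
  rw [this, norm_mul]
  have h1 : ‖Complex.exp V‖ ≤ 2 := by
    have := norm_exp_sub_one_le_two_mul (hV.trans (by norm_num))
    have h2 := norm_sub_norm_le (Complex.exp V) 1
    rw [norm_one] at h2
    linarith
  have h3 := norm_exp_sub_one_le_two_mul (z := U - V) (by linarith [norm_sub_le U V])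
  calc ‖Complex.exp V‖ * ‖Complex.exp (U - V) - 1‖ ≤ 2 * (2 * ‖U - V‖) := by gcongr
    _ = _ := by ring

theorem tendstoUniformlyOn_twist {u : ℂ → ℂ} {v : ℂ × ℂ → ℂ} {S : Set (ℂ × ℂ)} {F : ℕ → ℂ → ℂ} {G : ℕ → ℂ × ℂ → ℂ}
    (hS : ∀ x ∈ S, ‖x.1‖ ≤ 1 ∧ ‖x.2‖ ≤ 1)
    (hF : TendstoUniformlyOn (fun n x => F n x.1) (fun x => u x.1) atTop S)
    (hG : TendstoUniformlyOn G v atTop S)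
    (hF' : ∀ n, ∀ x ∈ S, ‖F n x.1‖ ≤ 1 / 2) (hG' : ∀ n, ∀ x ∈ S, ‖G n x‖ ≤ 1 / 2)
    (hu : ∀ x ∈ S, ‖u x.1‖ ≤ 1 / 2) (hv : ∀ x ∈ S, ‖v x‖ ≤ 1 / 2) :
    TendstoUniformlyOn (fun n => twist (F n) (G n)) (twist u v) atTop S := by
  rw [Metric.tendstoUniformlyOn_iff] at *
  intro ε hε
  have key : ∀ {z U V : ℂ}, ‖z‖ ≤ 1 → ‖U‖ ≤ 1 / 2 → ‖V‖ ≤ 1 / 2 → dist U V < ε / 4 →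
      dist (z * Complex.exp U) (z * Complex.exp V) < ε := by
    intro z U V hz hU hV hUV
    rw [dist_eq_norm] at *
    rw [← mul_sub, norm_mul]
    calc ‖z‖ * ‖Complex.exp U - Complex.exp V‖ ≤ 1 * (4 * ‖U - V‖) := by
          gcongr; exact norm_exp_sub_exp_le hU hV
      _ < ε := by linarith
  filter_upwards [hF (ε / 4) (by positivity), hG (ε / 4) (by positivity)] with n h1 h2 x hx
  rw [Prod.dist_eq, max_lt_iff]
  exact ⟨key (hS x hx).1 (hu x hx) (hF' n x hx) (h1 x hx),
    key (hS x hx).2 (hv x hx) (hG' n x hx) (h2 x hx)⟩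

end Estimates


/-! ### Uniform smallness and the proof of the theorem. -/

section Main

variable {l₁ L : ℝ} {p : ℂ → ℂ} {q : ℂ × ℂ → ℂ} {a : ℂ} {b : ℕ → ℕ → ℂ} {δ γ d : ℕ} {ρ : ℝ}

/-- The logarithms of the approximate conjugacies are uniformly small on small wedges. -/
theorem exists_wedge_norm_log_le
    (h : ∀ ε > 0, ε ≤ 1 / 2 → ∃ ρ > 0, ∀ r, 0 < r → r ≤ ρ → IsTame l₁ L p q a b δ γ d ε r)
    {η r₀ : ℝ} (hη : 0 < η) (hr₀ : 0 < r₀) :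
    ∃ r, 0 < r ∧ r ≤ r₀ ∧ (∀ n, ∀ z ∈ Metric.ball (0 : ℂ) r, ‖logFst p a δ n z‖ ≤ η) ∧
      ∀ n, ∀ x ∈ wedge l₁ L r, ‖logSnd p q a b δ γ d n x‖ ≤ η := by
  have hγ : (0 : ℝ) ≤ γ := Nat.cast_nonneg _
  obtain ⟨ρ, hρ, hT⟩ := h (min (1 / 2) (η / (2 * (1 + 2 * γ)))) (by positivity) (min_le_left _ _)
  have hr : 0 < min ρ r₀ := lt_min hρ hr₀
  have hε : (1 + 2 * γ) * (2 * min (1 / 2) (η / (2 * (1 + 2 * γ)))) ≤ η := by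
    calc _ ≤ (1 + 2 * γ) * (2 * (η / (2 * (1 + 2 * γ)))) := by gcongr; exact min_le_right _ _
      _ = η := by field_simp
  have T := hT _ hr (min_le_left _ _)
  refine ⟨min ρ r₀, hr, min_le_right _ _, fun n z hz => (T.norm_logFst_le n hz).trans (le_trans ?_ hε),
    fun n x hx => (T.norm_logSnd_le n (mem_insert_of_mem 0 hx)).trans hε⟩
  have := T.ε_nonneg
  nlinarith [mul_nonneg hγ this]

theorem twist_sub_le {u : ℂ → ℂ} {v : ℂ × ℂ → ℂ} {x : ℂ × ℂ} {κ : ℝ} (hκ : κ ≤ 1)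
    (hu : ‖u x.1‖ ≤ κ) (hv : ‖v x‖ ≤ κ) :
    ‖(twist u v x).1 - x.1‖ ≤ 2 * κ * ‖x.1‖ ∧ ‖(twist u v x).2 - x.2‖ ≤ 2 * κ * ‖x.2‖ :=
  ⟨norm_mul_exp_sub_le hκ hu, norm_mul_exp_sub_le hκ hv⟩

end Main

end SkewBottcher

theorem mainTheorem2
    (p : ℂ → ℂ) (q : ℂ × ℂ → ℂ) (a : ℂ) (δ : ℕ) (b : ℕ → ℕ → ℂ)
    (hp : AnalyticAt ℂ p 0) (hq : AnalyticAt ℂ q 0)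
    (hsuper : SkewBottcher.IsSuperattracting (SkewBottcher.skew p q))
    (ha : a ≠ 0)
    (hpa : (fun z : ℂ => p z - a * z ^ δ) =O[𝓝 0] (fun z : ℂ => z ^ (δ + 1)))
    (hqb : SkewBottcher.HasExpansion q b)
    (s : ℕ) (n m : ℕ → ℕ) (hvert : SkewBottcher.IsVertexList b s n m)
    (γ d : ℕ) (l₁ l₂inv : ℝ) (hdom : SkewBottcher.IsDominant δ s n m γ d l₁ l₂inv)
    (hd : 2 ≤ d)
    (f f₀ : ℂ × ℂ → ℂ × ℂ) (hf : f = SkewBottcher.skew p q)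
    (hf₀ : f₀ = SkewBottcher.monomialMap a (b γ d) δ γ d)
    (U : ℝ → Set (ℂ × ℂ)) (hU : U = SkewBottcher.wedge l₁ l₂inv) :
    ∃ r₀ : ℝ, 0 < r₀ ∧ ∃ φ : ℂ × ℂ → ℂ × ℂ, φ 0 = 0 ∧
      (∀ r : ℝ, 0 < r → r ≤ r₀ →
        SkewBottcher.IsBiholomorphicOn φ (U r) ∧
        ∀ x ∈ U r, (f x ∈ U r ∨ (x.1 = 0 ∧ γ ≠ 0 ∧ f x = 0)) ∧ φ (f x) = f₀ (φ x)) ∧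
      (∃ φn : ℕ → ℂ × ℂ → ℂ × ℂ,
        (∀ N : ℕ, SkewBottcher.IsBranch f f₀ U r₀ N (φn N)) ∧
        TendstoUniformlyOn φn φ atTop (U r₀)) ∧
      (∀ ε : ℝ, 0 < ε → ∃ r : ℝ, 0 < r ∧ r ≤ r₀ ∧
        ∀ x ∈ U r, x ≠ 0 → ‖φ x - x‖ < ε * ‖x‖) := by
  open SkewBottcher in
  subst hf hf₀ hU
  have hadm := hdom.isAdmissible hvert (two_le_of_isSuperattracting hp hq hsuper ha hpa) hd
  have hp0 : p 0 = 0 := congrArg Prod.fst hsuper.1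
  have hq0 : q 0 = 0 := congrArg Prod.snd hsuper.1
  have htame : ∀ ε > 0, ε ≤ 1 / 2 →
      ∃ ρ > 0, ∀ r, 0 < r → r ≤ ρ → IsTame l₁ l₂inv p q a b δ γ d ε r := fun ε hε hε' =>
    exists_isTame hadm hp hp0 hq0 ha hpa hqb hε hε'
  obtain ⟨ρ₀, hρ₀, hT⟩ := htame (1 / 2) (by norm_num) le_rfl
  -- 1/20 is the bound on the logarithms that the injectivity argument needs.
  obtain ⟨ρ, hρ, hρρ₀, hsmall₁, hsmall₂⟩ := exists_wedge_norm_log_le htame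
    (show (0 : ℝ) < 1 / 20 by norm_num) hρ₀
  have T := hT ρ hρ hρρ₀
  have hL := hadm.L_nonneg
  have hl := hadm.l₁_nonneg
  obtain ⟨u, v, hu, hv⟩ := T.exists_limit
  have hv' := hv.mono (Set.subset_insert 0 (wedge l₁ l₂inv ρ))
  have hud : DifferentiableOn ℂ u (Metric.ball 0 ρ) :=
    differentiableOn_of_tendstoUniformlyOn Metric.isOpen_ball T.differentiableOn_logFst hu
  have hvd : DifferentiableOn ℂ v (wedge l₁ l₂inv ρ) :=
    differentiableOn_of_tendstoUniformlyOn (isOpen_wedge hl hL) T.differentiableOn_logSnd hv'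
  have hu_le : ∀ {η : ℝ} {z : ℂ}, z ∈ Metric.ball (0 : ℂ) ρ → (∀ n, ‖logFst p a δ n z‖ ≤ η) →
      ‖u z‖ ≤ η := fun hz hη =>
    le_of_tendsto (hu.tendsto_at hz).norm (Eventually.of_forall hη)
  have hv_le : ∀ {η : ℝ} {x : ℂ × ℂ}, x ∈ wedge l₁ l₂inv ρ →
      (∀ n, ‖logSnd p q a b δ γ d n x‖ ≤ η) → ‖v x‖ ≤ η := fun hx hη =>
    le_of_tendsto (hv'.tendsto_at hx).norm (Eventually.of_forall hη)
  have hfst : ∀ {r : ℝ} {x : ℂ × ℂ}, r ≤ ρ → x ∈ wedge l₁ l₂inv r →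
      x.1 ∈ Metric.ball (0 : ℂ) r := fun hr hx => by
    rw [mem_ball_zero_iff]
    exact norm_fst_lt hL (hr.trans T.ρ_le_one) hx
  have htwo : (1 : ℝ) ≤ 2 ^ (l₂inv + 1) := Real.one_le_rpow one_le_two (by linarith)
  -- The smaller radius leaves room for the discs in the w-slices, on which Cauchy's estimates are
  -- applied inside the wedge of radius ρ.
  set r₀ := ρ / 2 ^ (l₂inv + 1) with hr₀def
  have hr₀ : 0 < r₀ := by positivity
  have hr₀ρ : r₀ ≤ ρ := div_le_self hρ.le htwo
  have hmul : 2 ^ (l₂inv + 1) * r₀ = ρ := mul_div_cancel₀ _ (by positivity)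
  have hsub : ∀ {r : ℝ}, r ≤ r₀ → wedge l₁ l₂inv r ⊆ wedge l₁ l₂inv ρ := fun hr =>
    wedge_mono (hr.trans hr₀ρ)
  refine ⟨r₀, hr₀, twist u v, twist_zero u v, fun r hr hrr₀ => ⟨?_, fun x hx => ⟨?_, ?_⟩⟩,
    ⟨fun N => twist (logFst p a δ N) (logSnd p q a b δ γ d N), fun N => ⟨?_, ?_, ?_⟩, ?_⟩, ?_⟩
  · refine isBiholomorphicOn_twist hl hL T.ρ_le_one ?_ hud hvd (T.differentiableOn_twist hud hvd)
      (fun z hz => hu_le hz fun n => hsmall₁ n z hz) (fun x hx => hv_le hx fun n => hsmall₂ n x hx)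
    rw [← hmul]
    gcongr
  · exact T.skew_mem (hrr₀.trans hr₀ρ) hx
  · exact T.monomialMap_twist_limit hu hv (Set.mem_insert_of_mem _ (hsub hrr₀ hx))
  · exact (T.differentiableOn_twist (T.differentiableOn_logFst N)
      (T.differentiableOn_logSnd N)).mono (hsub le_rfl)
  · exact fun x hx => T.iterate_monomialMap_twist N (Set.mem_insert_of_mem _ (hsub le_rfl hx))
  · intro ε hε
    obtain ⟨r, hr, hrr₀, h1, h2⟩ := exists_wedge_norm_log_le htame
      (show 0 < min 1 (ε / 2) by positivity) hr₀
    refine ⟨r, hr, hrr₀, fun x hx => ?_⟩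
    have hle : 2 * min 1 (ε / 2) ≤ ε := by linarith [min_le_right 1 (ε / 2)]
    obtain ⟨e1, e2⟩ := twist_sub_le (min_le_left _ _)
      (h1 N _ (hfst (hrr₀.trans hr₀ρ) hx)) (h2 N x hx)
    exact ⟨e1.trans (by gcongr), e2.trans (by gcongr)⟩
  · refine tendstoUniformlyOn_twist (fun x hx => ⟨?_, ?_⟩) ?_ (hv'.mono (hsub le_rfl))
      (fun n x hx => ?_) (fun n x hx => ?_) (fun x hx => ?_) (fun x hx => ?_)
    · exact (norm_fst_lt hL (hr₀ρ.trans T.ρ_le_one) hx).le.trans (hr₀ρ.trans T.ρ_le_one)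
    · exact (norm_snd_lt hl hL (hr₀ρ.trans T.ρ_le_one) hx).le.trans (hr₀ρ.trans T.ρ_le_one)
    · exact (hu.comp Prod.fst).mono fun x hx => hfst le_rfl (hsub le_rfl hx)
    · exact (hsmall₁ n _ (hfst le_rfl (hsub le_rfl hx))).trans (by norm_num)
    · exact (hsmall₂ n _ (hsub le_rfl hx)).trans (by norm_num)
    · have hx' := hfst le_rfl (hsub le_rfl hx)
      exact (hu_le hx' fun n => hsmall₁ n _ hx').trans (by norm_num)
    · have hx' := hsub le_rfl hx
      exact (hv_le hx' fun n => hsmall₂ n _ hx').trans (by norm_num)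
  · intro ε hε
    obtain ⟨r, hr, hrr₀, h1, h2⟩ := exists_wedge_norm_log_le htame
      (show 0 < min 1 (ε / 4) by positivity) hr₀
    refine ⟨r, hr, hrr₀, fun x hx hx0 => ?_⟩
    have hxz := hfst (hrr₀.trans hr₀ρ) hx
    have hle : 2 * min 1 (ε / 4) ≤ ε / 2 := by linarith [min_le_right 1 (ε / 4)]
    obtain ⟨e1, e2⟩ := twist_sub_le (min_le_left _ _)
      (hu_le (hfst le_rfl (hsub hrr₀ hx)) fun n => h1 n _ hxz)
      (hv_le (hsub hrr₀ hx) fun n => h2 n x hx)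
    have hx0' := norm_pos_iff.2 hx0
    have hle' : ‖twist u v x - x‖ ≤ ε / 2 * ‖x‖ := by
      rw [Prod.norm_def, max_le_iff]
      exact ⟨e1.trans (mul_le_mul hle (norm_fst_le x) (norm_nonneg _) (by positivity)),
        e2.trans (mul_le_mul hle (norm_snd_le x) (norm_nonneg _) (by positivity))⟩
    refine hle'.trans_lt ?_
    have := mul_pos hε hx0'
    linarith
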